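/- Let $n$ be the dimension and write $B_r$ for the open ball of radius $r$ centred at $0$ in $\mathbb R^n$, and $f_+:=\max(f,0)$. Given $\Lambda>0$, there is $\delta>0$, depending only on $\Lambda$ and $n$, such that the following holds. Let $A$ be a measurable field of real symmetric $n\times n$ matrices on $B_1$ with $\Lambda^{-1}|\xi|^2\le A(x)\xi\cdot\xi\le\Lambda|\xi|^2$ for all $\xi\in\mathbb R^n$ and almost every $x\in B_1$, and let $f\in H^1(B_1)$ be a weak subsolution of $\nabla\cdot(A\nabla f)\ge 0$ in $B_1$, that is, $$\int_{B_1} A\nabla f\cdot\nabla\varphi\,\mathrm dx\le 0\qquad\text{for all } \varphi\in C_c^\infty(B_1),\ \varphi\ge 0 .$$ Then $$\|f_+\|_{L^2(B_1)}\le\delta\quad\Longrightarrow\quad\|f_+\|_{L^\infty(B_{1/2})}\le\tfrac12 .$$ -/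

import Mathlib

open MeasureTheory
open scoped ENNReal ContDiff

namespace DeGiorgi

/-- `φ ∈ C_c^∞(U)`. -/
structure IsTestFunction {n : ℕ} (U : Set (EuclideanSpace ℝ (Fin n)))
    (φ : EuclideanSpace ℝ (Fin n) → ℝ) : Prop where
  contDiff : ContDiff ℝ ∞ φ
  hasCompactSupport : HasCompactSupport φ
  tsupport_subset : tsupport φ ⊆ U

/-- `G` is the weak (distributional) gradient of `f` on the open set `U`: both are locally
integrable on `U`, and `∫_U f ∂ᵢφ = - ∫_U Gᵢ φ` for all `φ ∈ C_c^∞(U)` and all `i`. Only the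
values of `f` and `G` on `U`, up to null sets, matter. -/
structure HasWeakGradient {n : ℕ} (U : Set (EuclideanSpace ℝ (Fin n)))
    (f : EuclideanSpace ℝ (Fin n) → ℝ)
    (G : EuclideanSpace ℝ (Fin n) → EuclideanSpace ℝ (Fin n)) : Prop where
  locallyIntegrableOn : LocallyIntegrableOn f U volume
  locallyIntegrableOn_gradient : LocallyIntegrableOn G U volume
  integral_eq : ∀ φ : EuclideanSpace ℝ (Fin n) → ℝ, IsTestFunction U φ → ∀ i : Fin n,
    ∫ x in U, f x * gradient φ x i = - ∫ x in U, G x i * φ x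

/-- `f ∈ H¹(U)`: `f ∈ L²(U)` with a weak gradient in `L²(U)`. -/
def MemH1 {n : ℕ} (U : Set (EuclideanSpace ℝ (Fin n)))
    (f : EuclideanSpace ℝ (Fin n) → ℝ) : Prop :=
  MemLp f 2 (volume.restrict U) ∧
    ∃ G : EuclideanSpace ℝ (Fin n) → EuclideanSpace ℝ (Fin n),
      HasWeakGradient U f G ∧ MemLp G 2 (volume.restrict U)

/-- `A` is a measurable field of symmetric matrices on `U` with `Λ⁻¹ ≤ A(x) ≤ Λ` for almost
every `x ∈ U`, as quadratic forms. -/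
structure IsUniformlyElliptic {n : ℕ} (U : Set (EuclideanSpace ℝ (Fin n))) (Λ : ℝ)
    (A : EuclideanSpace ℝ (Fin n) → Matrix (Fin n) (Fin n) ℝ) : Prop where
  aemeasurable : ∀ i j : Fin n, AEMeasurable (fun x => A x i j) (volume.restrict U)
  isSymm : ∀ᵐ x ∂(volume.restrict U), (A x).IsSymm
  bounds : ∀ᵐ x ∂(volume.restrict U), ∀ ξ : EuclideanSpace ℝ (Fin n),
    Λ⁻¹ * ‖ξ‖ ^ 2 ≤ inner ℝ (Matrix.toEuclideanLin (A x) ξ) ξ ∧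
      inner ℝ (Matrix.toEuclideanLin (A x) ξ) ξ ≤ Λ * ‖ξ‖ ^ 2

/-- `f` satisfies `∇ · (A ∇f) ≥ 0` weakly on `U`: its weak gradient `∇f` is in `L²(U)`, and
`∫_U (A ∇f) · ∇φ ≤ 0` for all `0 ≤ φ ∈ C_c^∞(U)`. Since weak gradients are unique up to null
sets, the choice of the representative `G` of `∇f` is irrelevant. -/
def IsWeakSubsolution {n : ℕ} (U : Set (EuclideanSpace ℝ (Fin n)))
    (A : EuclideanSpace ℝ (Fin n) → Matrix (Fin n) (Fin n) ℝ)
    (f : EuclideanSpace ℝ (Fin n) → ℝ) : Prop :=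
  ∃ G : EuclideanSpace ℝ (Fin n) → EuclideanSpace ℝ (Fin n),
    HasWeakGradient U f G ∧ MemLp G 2 (volume.restrict U) ∧
      ∀ φ : EuclideanSpace ℝ (Fin n) → ℝ, IsTestFunction U φ → (∀ x, 0 ≤ φ x) →
        ∫ x in U, inner ℝ (Matrix.toEuclideanLin (A x) (G x)) (gradient φ x) ≤ 0

end DeGiorgi

/-! This is De Giorgi's iteration. Take levels `l k` increasing from `0` to `1/2`, sets `‖x‖² < s k`
with `s k` decreasing from `1/2` to `1/4`, and energies `P k = ‖(f - l k)₊‖²` in `L²` of the `k`-th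
set. If `P k → 0`, then `(f - 1/2)₊` vanishes almost everywhere on the ball of radius `1/2`.

The decay comes from a superlinear recursion `P (k+1) ≤ C 8^k P k ^ (1+α)` (`exists_energy_step`).
Let `w` be the truncation at the higher level and `η` a cutoff. Testing the inequality with `η² w`
controls the gradient of `η w` by `w ∇η` (`caccioppoli`). The Sobolev embedding of `W₀^{1,1}` into
`L^q`, `q > 1`, applied to `(η w)²`, turns this into an `L^q` bound of `(η w)²`
(`eLpNorm_sq_mul_le`). Hölder on the support of `η w` then gains a power `α = 1 - 1/q` of the
measure of `{f > l'}`, which Chebyshev bounds by the energy at the lower level: this is the exponent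
above one. Such a recursion beats the geometric factor once `P 0` is small
(`exists_tendsto_zero_of_superlinear`).

Since test functions are smooth and `f` is only in `H¹`, truncations and products with cutoffs are
handled through strong `L²` limits: mollification gives smooth approximants of `f`, and composing
them with a smooth ramp gives nonnegative smooth approximants of `(f - l)₊`
(`exists_smooth_tendsto_posPart`). Dimension zero has no Sobolev gain and is treated apart. -/

namespace DeGiorgi
open Filter Topology
open scoped Convolution NNReal

/-! ### Mollification in `L²`. -/

section Mollification
variable {E F : Type*} [NormedAddCommGroup E] [InnerProductSpace ℝ E] [FiniteDimensional ℝ E]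
  [MeasurableSpace E] [BorelSpace E] [NormedAddCommGroup F] [NormedSpace ℝ F]

/-- Jensen's inequality for the probability density `w`: write `w h = w^{1/2} · (w^{1/2} h)` and
apply Cauchy–Schwarz. -/
theorem sq_lintegral_mul_le_lintegral_mul_sq {α : Type*} [MeasurableSpace α] {μ : Measure α}
    {w h : α → ℝ≥0∞} (hw : AEMeasurable w μ) (hh : AEMeasurable h μ) (h1 : ∫⁻ t, w t ∂μ = 1) :
    (∫⁻ t, w t * h t ∂μ) ^ (2 : ℝ) ≤ ∫⁻ t, w t * h t ^ (2 : ℝ) ∂μ := by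
  have key : ∫⁻ t, w t * h t ∂μ ≤ (∫⁻ t, w t * h t ^ (2 : ℝ) ∂μ) ^ (1 / 2 : ℝ) := by
    calc ∫⁻ t, w t * h t ∂μ
        = ∫⁻ t, ((fun t => w t ^ (1 / 2 : ℝ)) * fun t => w t ^ (1 / 2 : ℝ) * h t) t ∂μ := by
          refine lintegral_congr fun t => ?_
          simp only [Pi.mul_apply]
          rw [← mul_assoc, ← ENNReal.rpow_add_of_nonneg _ _ (by norm_num) (by norm_num)]
          norm_num
      _ ≤ (∫⁻ t, (w t ^ (1 / 2 : ℝ)) ^ (2 : ℝ) ∂μ) ^ (1 / 2 : ℝ) *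
          (∫⁻ t, (w t ^ (1 / 2 : ℝ) * h t) ^ (2 : ℝ) ∂μ) ^ (1 / 2 : ℝ) :=
          ENNReal.lintegral_mul_le_Lp_mul_Lq μ Real.HolderConjugate.two_two
            (hw.pow_const _) ((hw.pow_const _).mul hh)
      _ = _ := by
          have e1 : ∀ t, (w t ^ (1 / 2 : ℝ)) ^ (2 : ℝ) = w t := fun t => by
            rw [← ENNReal.rpow_mul]; norm_num
          have e2 : ∀ t, (w t ^ (1 / 2 : ℝ) * h t) ^ (2 : ℝ) = w t * h t ^ (2 : ℝ) := fun t => by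
            rw [ENNReal.mul_rpow_of_nonneg _ _ (by norm_num), e1]
          simp_rw [e1, e2, h1]
          simp
  calc (∫⁻ t, w t * h t ∂μ) ^ (2 : ℝ)
      ≤ ((∫⁻ t, w t * h t ^ (2 : ℝ) ∂μ) ^ (1 / 2 : ℝ)) ^ (2 : ℝ) :=
        ENNReal.rpow_le_rpow key (by norm_num)
    _ = _ := by rw [← ENNReal.rpow_mul]; norm_num

theorem eLpNorm_two_rpow {α F : Type*} [MeasurableSpace α] [NormedAddCommGroup F] (f : α → F)
    (μ : Measure α) : eLpNorm f 2 μ ^ (2 : ℝ) = ∫⁻ x, ‖f x‖ₑ ^ (2 : ℝ) ∂μ := by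
  rw [eLpNorm_eq_lintegral_rpow_enorm_toReal (by norm_num) (by norm_num), ← ENNReal.rpow_mul]
  norm_num

theorem eLpNorm_two_le_of_lintegral_le {α F F' : Type*} [MeasurableSpace α]
    [NormedAddCommGroup F] [NormedAddCommGroup F'] {f : α → F} {g : α → F'}
    {μ ν : Measure α} (h : ∫⁻ x, ‖f x‖ₑ ^ (2 : ℝ) ∂μ ≤ ∫⁻ x, ‖g x‖ₑ ^ (2 : ℝ) ∂ν) :
    eLpNorm f 2 μ ≤ eLpNorm g 2 ν := by
  rw [← eLpNorm_two_rpow, ← eLpNorm_two_rpow] at h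
  exact (ENNReal.rpow_le_rpow_iff (by norm_num)).1 h

/-- Young's inequality for the convolution of an `L²` function with a bump function of mass one. -/
theorem eLpNorm_normed_convolution_le (φ : ContDiffBump (0 : E)) {g : E → F}
    (hg : AEStronglyMeasurable g volume) :
    eLpNorm (φ.normed volume ⋆[ContinuousLinearMap.lsmul ℝ ℝ, volume] g) 2 volume ≤
      eLpNorm g 2 volume := by
  apply eLpNorm_two_le_of_lintegral_le
  have hφ : ∫⁻ t, ‖φ.normed volume t‖ₑ = 1 := by
    rw [← ofReal_integral_norm_eq_lintegral_enorm φ.integrable_normed]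
    simp_rw [Real.norm_of_nonneg (φ.nonneg_normed _), φ.integral_normed]
    simp
  have hφm : Measurable fun t => ‖φ.normed volume t‖ₑ :=
    φ.continuous_normed.enorm.measurable
  have hpt : ∀ x, ‖(φ.normed volume ⋆[ContinuousLinearMap.lsmul ℝ ℝ, volume] g) x‖ₑ ^ (2 : ℝ) ≤
      ∫⁻ t, ‖φ.normed volume t‖ₑ * ‖g (x - t)‖ₑ ^ (2 : ℝ) := by
    intro x
    have hgx : AEStronglyMeasurable (fun t => g (x - t)) volume :=
      hg.comp_measurePreserving (Measure.measurePreserving_sub_left volume x)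
    refine le_trans (ENNReal.rpow_le_rpow ?_ (by norm_num))
      (sq_lintegral_mul_le_lintegral_mul_sq hφm.aemeasurable hgx.enorm hφ)
    refine (enorm_integral_le_lintegral_enorm _).trans (le_of_eq ?_)
    refine lintegral_congr fun t => ?_
    simp [enorm_smul]
  calc _ ≤ ∫⁻ x, ∫⁻ t, ‖φ.normed volume t‖ₑ * ‖g (x - t)‖ₑ ^ (2 : ℝ) := lintegral_mono hpt
    _ = ∫⁻ t, ∫⁻ x, ‖φ.normed volume t‖ₑ * ‖g (x - t)‖ₑ ^ (2 : ℝ) := by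
        refine lintegral_lintegral_swap ?_
        refine AEMeasurable.mul (hφm.comp measurable_snd).aemeasurable ?_
        refine AEMeasurable.pow_const ?_ _
        exact (hg.comp_quasiMeasurePreserving
          (quasiMeasurePreserving_sub volume volume)).enorm
    _ = ∫⁻ t, ‖φ.normed volume t‖ₑ * ∫⁻ x, ‖g x‖ₑ ^ (2 : ℝ) := by
        refine lintegral_congr fun t => ?_
        have hgt : AEStronglyMeasurable (fun x => g (x - t)) volume :=
          hg.comp_measurePreserving (measurePreserving_sub_right volume t)
        rw [lintegral_const_mul'' _ (hgt.enorm.pow_const _)]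
        congr 1
        exact lintegral_sub_right_eq_self (fun x => ‖g x‖ₑ ^ (2 : ℝ)) t
    _ = _ := by
        rw [lintegral_mul_const _ hφm, hφ, one_mul]

/-- Mollification converges in `L²` on sets of finite measure. -/
theorem tendsto_eLpNorm_normed_convolution_sub [CompleteSpace F] {φ : ℕ → ContDiffBump (0 : E)}
    (hφ : Tendsto (fun j => (φ j).rOut) atTop (𝓝 0)) {g : E → F} (hg : MemLp g 2 volume)
    {s : Set E} (hs : volume s ≠ ⊤) :
    Tendsto (fun j => eLpNorm ((φ j).normed volume ⋆[ContinuousLinearMap.lsmul ℝ ℝ, volume] g - g)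
      2 (volume.restrict s)) atTop (𝓝 0) := by
  rw [ENNReal.tendsto_nhds_zero]
  intro ε hε
  wlog hεt : ε ≠ ⊤ generalizing ε
  · simp only [ne_eq, not_not] at hεt; simp [hεt]
  have hε3 : ε / 3 ≠ 0 := by simp [hε.ne']
  obtain ⟨c, hcs, hc, hcc, hcm⟩ := hg.exists_hasCompactSupport_eLpNorm_sub_le (by norm_num) hε3
  have hcu : UniformContinuous c := hcs.uniformContinuous_of_continuous hcc
  obtain ⟨η, hη0, hη⟩ : ∃ η : ℝ, 0 < η ∧
      ENNReal.ofReal η * (volume s) ^ (1 / 2 : ℝ) ≤ ε / 3 := by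
    have hv : (volume s) ^ (1 / 2 : ℝ) ≠ ⊤ := ENNReal.rpow_ne_top_of_nonneg (by norm_num) hs
    have : Tendsto (fun η : ℝ => ENNReal.ofReal η * (volume s) ^ (1 / 2 : ℝ)) (𝓝[>] 0) (𝓝 0) := by
      have h0 : Tendsto (fun η : ℝ => ENNReal.ofReal η) (𝓝[>] 0) (𝓝 0) := by
        have := (ENNReal.continuous_ofReal.tendsto 0).mono_left
          (nhdsWithin_le_nhds (s := Set.Ioi (0 : ℝ)))
        simpa using this
      simpa using ENNReal.Tendsto.mul_const h0 (Or.inr hv)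
    obtain ⟨η, h1, h2⟩ := ((ENNReal.tendsto_nhds_zero.1 this (ε / 3)
      (pos_iff_ne_zero.2 hε3)).and self_mem_nhdsWithin).exists
    exact ⟨η, h2, h1⟩
  obtain ⟨r, hr, hcr⟩ := Metric.uniformContinuous_iff.1 hcu η hη0
  filter_upwards [hφ.eventually (gt_mem_nhds hr)] with j hj
  set K := (φ j).normed volume
  have hK : HasCompactSupport K := (φ j).hasCompactSupport_normed
  have hex : ∀ {h : E → F}, LocallyIntegrable h volume →
      ConvolutionExists K h (ContinuousLinearMap.lsmul ℝ ℝ) volume := fun hh =>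
    hK.convolutionExists_left _ (φ j).continuous_normed hh
  have hgl : LocallyIntegrable g volume := hg.locallyIntegrable (by norm_num)
  have hcl : LocallyIntegrable c volume := hcc.locallyIntegrable
  -- With `c` continuous of compact support close to `g`, the first term is small by Young's
  -- inequality, the second by uniform continuity of `c` on a set of finite measure, the third by
  -- the choice of `c`.
  have hsplit : K ⋆[ContinuousLinearMap.lsmul ℝ ℝ, volume] g - g =
      (K ⋆[ContinuousLinearMap.lsmul ℝ ℝ, volume] (g - c)) +
        ((K ⋆[ContinuousLinearMap.lsmul ℝ ℝ, volume] c - c) + (c - g)) := by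
    have : K ⋆[ContinuousLinearMap.lsmul ℝ ℝ, volume] g =
        (K ⋆[ContinuousLinearMap.lsmul ℝ ℝ, volume] (g - c)) +
          K ⋆[ContinuousLinearMap.lsmul ℝ ℝ, volume] c := by
      rw [← ConvolutionExists.distrib_add (hex (hgl.sub hcl)) (hex hcl), sub_add_cancel]
    rw [this]; abel
  have hKg : ∀ {h : E → F}, LocallyIntegrable h volume →
      Continuous (K ⋆[ContinuousLinearMap.lsmul ℝ ℝ, volume] h) := fun hh =>
    hK.continuous_convolution_left _ (φ j).continuous_normed hh
  have hb1 : eLpNorm (K ⋆[ContinuousLinearMap.lsmul ℝ ℝ, volume] (g - c)) 2 (volume.restrict s) ≤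
      ε / 3 :=
    (eLpNorm_restrict_le _ _ _ _).trans
      ((eLpNorm_normed_convolution_le (φ j) (hg.1.sub hcm.1)).trans hc)
  have hb3 : eLpNorm (c - g) 2 (volume.restrict s) ≤ ε / 3 := by
    rw [eLpNorm_sub_comm]; exact (eLpNorm_restrict_le _ _ _ _).trans hc
  have hb2 : eLpNorm (K ⋆[ContinuousLinearMap.lsmul ℝ ℝ, volume] c - c) 2 (volume.restrict s) ≤
      ε / 3 := by
    refine (eLpNorm_le_of_ae_bound (C := η) (ae_of_all _ fun x => ?_)).trans ?_
    · rw [Pi.sub_apply, ← dist_eq_norm]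
      refine (φ j).dist_normed_convolution_le hcm.1 fun y hy => ?_
      exact (hcr ((Metric.mem_ball.1 hy).trans hj)).le
    · rw [mul_comm]; simpa using hη
  rw [hsplit]
  calc _ ≤ ε / 3 + (ε / 3 + ε / 3) := by
        refine (eLpNorm_add_le (hKg (hgl.sub hcl)).aestronglyMeasurable
          (((hKg hcl).sub hcc).aestronglyMeasurable.add
            (hcm.1.sub hg.1).restrict) (by norm_num)).trans (add_le_add hb1 ?_)
        exact (eLpNorm_add_le ((hKg hcl).sub hcc).aestronglyMeasurable
            (hcm.1.sub hg.1).restrict (by norm_num)).trans (add_le_add hb2 hb3)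
    _ = ε := by rw [← add_assoc, ENNReal.add_thirds]
end Mollification

/-! ### Calculus rules for `gradient`. -/

section Gradient
variable {E : Type*} [NormedAddCommGroup E] [InnerProductSpace ℝ E] [CompleteSpace E]

theorem norm_gradient_eq (u : E → ℝ) (x : E) : ‖gradient u x‖ = ‖fderiv ℝ u x‖ := by
  rw [gradient, LinearIsometryEquiv.norm_map]

theorem gradient_mul {u v : E → ℝ} {x : E} (hu : DifferentiableAt ℝ u x)
    (hv : DifferentiableAt ℝ v x) :
    gradient (fun y => u y * v y) x = u x • gradient v x + v x • gradient u x := by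
  simp only [gradient]
  rw [fderiv_fun_mul hu hv]
  simp

theorem gradient_comp_real {β : ℝ → ℝ} {u : E → ℝ} {x : E} (hβ : DifferentiableAt ℝ β (u x))
    (hu : DifferentiableAt ℝ u x) :
    gradient (fun y => β (u y)) x = deriv β (u x) • gradient u x := by
  simp only [gradient]
  have h : fderiv ℝ (fun y => β (u y)) x = _ :=
    (hβ.hasDerivAt.comp_hasFDerivAt x hu.hasFDerivAt).fderiv
  rw [h]
  simp

theorem continuous_gradient {u : E → ℝ} (hu : ContDiff ℝ 1 u) : Continuous (gradient u) :=
  (InnerProductSpace.toDual ℝ E).symm.continuous.comp (hu.continuous_fderiv one_ne_zero)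

theorem gradient_eq_zero_of_notMem_tsupport {u : E → ℝ} {x : E} (hx : x ∉ tsupport u) :
    gradient u x = 0 := by
  rw [gradient, fderiv_of_notMem_tsupport ℝ hx]
  simp

theorem gradient_apply_coord {n : ℕ} (u : EuclideanSpace ℝ (Fin n) → ℝ)
    (x : EuclideanSpace ℝ (Fin n)) (i : Fin n) :
    gradient u x i = fderiv ℝ u x (EuclideanSpace.single i 1) := by
  rw [← inner_gradient_left, EuclideanSpace.inner_single_right]
  simp

end Gradient

/-! ### Smooth approximation of `H¹` functions on a smaller ball. -/

section Approximation
variable {n : ℕ}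

theorem isTestFunction_bump_sub {U : Set (EuclideanSpace ℝ (Fin n))}
    (φ : ContDiffBump (0 : EuclideanSpace ℝ (Fin n))) {x : EuclideanSpace ℝ (Fin n)}
    (hx : Metric.closedBall x φ.rOut ⊆ U) :
    IsTestFunction U (fun y => φ.normed volume (x - y)) := by
  have hsub : tsupport (fun y => φ.normed volume (x - y)) ⊆ Metric.closedBall x φ.rOut := by
    refine closure_minimal (fun y hy => ?_) Metric.isClosed_closedBall
    have : x - y ∈ Metric.ball 0 φ.rOut := by
      rw [← φ.support_normed_eq (μ := volume)]; exact hy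
    rw [mem_ball_zero_iff, ← dist_eq_norm, dist_comm] at this
    exact this.le
  exact ⟨φ.contDiff_normed.comp (contDiff_const.sub contDiff_id),
    HasCompactSupport.of_support_subset_isCompact (isCompact_closedBall x φ.rOut)
      (subset_closure.trans hsub), hsub.trans hx⟩

/-- The translate `φ (x - ·)` is an admissible test function in `U` because the ball of radius
`rOut` about `x` lies in `U`. The extension by zero makes the convolution globally defined and does
not affect its value near such `x`. -/
theorem gradient_normed_convolution {U : Set (EuclideanSpace ℝ (Fin n))} (hU : MeasurableSet U)
    {f : EuclideanSpace ℝ (Fin n) → ℝ} {G : EuclideanSpace ℝ (Fin n) → EuclideanSpace ℝ (Fin n)}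
    (hw : HasWeakGradient U f G) (hf : LocallyIntegrable (U.indicator f) volume)
    (hG : LocallyIntegrable (U.indicator G) volume)
    (φ : ContDiffBump (0 : EuclideanSpace ℝ (Fin n))) {x : EuclideanSpace ℝ (Fin n)}
    (hx : Metric.closedBall x φ.rOut ⊆ U) :
    gradient (φ.normed volume ⋆[ContinuousLinearMap.lsmul ℝ ℝ, volume] U.indicator f) x =
      (φ.normed volume ⋆[ContinuousLinearMap.lsmul ℝ ℝ, volume] U.indicator G) x := by
  set K := φ.normed (volume : Measure (EuclideanSpace ℝ (Fin n))) with hKdef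
  have hK : HasCompactSupport K := φ.hasCompactSupport_normed
  have hKs : ContDiff ℝ 1 K := φ.contDiff_normed
  have htest := isTestFunction_bump_sub φ hx
  ext i
  rw [gradient_apply_coord,
    (hK.hasFDerivAt_convolution_left (ContinuousLinearMap.lsmul ℝ ℝ) hKs hf x).fderiv,
    convolution_eq_swap]
  have hint1 : Integrable (fun t => (ContinuousLinearMap.precompL (EuclideanSpace ℝ (Fin n))
      (ContinuousLinearMap.lsmul ℝ ℝ)) (fderiv ℝ K (x - t)) (U.indicator f t)) volume := by
    have := (hK.fderiv ℝ).convolutionExists_left (ContinuousLinearMap.precompL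
      (EuclideanSpace ℝ (Fin n)) (ContinuousLinearMap.lsmul ℝ ℝ))
      (hKs.continuous_fderiv one_ne_zero) hf x
    exact this.integrable_swap
  have hint2 : Integrable (fun t => K (x - t) • U.indicator G t) volume := by
    have := hK.convolutionExists_left (ContinuousLinearMap.lsmul ℝ ℝ)
      φ.continuous_normed hG x
    exact this.integrable_swap
  rw [ContinuousLinearMap.integral_apply hint1, convolution_lsmul_swap]
  have hproj := ContinuousLinearMap.integral_comp_comm (EuclideanSpace.proj (𝕜 := ℝ) i) hint2
  simp only [PiLp.proj_apply] at hproj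
  rw [← hproj]
  -- The sign from differentiating in `y` instead of `x` cancels the sign in the definition of the
  -- weak gradient.
  have hgrad : ∀ y, gradient (fun y => K (x - y)) y i =
      - fderiv ℝ K (x - y) (EuclideanSpace.single i 1) := by
    intro y
    rw [gradient_apply_coord]
    have h1 : HasFDerivAt (fun y => x - y)
        (-ContinuousLinearMap.id ℝ (EuclideanSpace ℝ (Fin n))) y := by
      simpa using (hasFDerivAt_id y).const_sub x
    have h2 := ((hKs.differentiable one_ne_zero) (x - y)).hasFDerivAt.comp y h1
    have h3 : fderiv ℝ (fun y => K (x - y)) y = _ := h2.fderiv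
    rw [h3]
    simp
  have hweak := hw.integral_eq _ htest i
  have e1 : ∫ t, (ContinuousLinearMap.precompL (EuclideanSpace ℝ (Fin n))
      (ContinuousLinearMap.lsmul ℝ ℝ)) (fderiv ℝ K (x - t)) (U.indicator f t)
        (EuclideanSpace.single i 1) =
      - ∫ y in U, f y * gradient (fun y => K (x - y)) y i := by
    rw [← integral_neg, ← integral_indicator hU]
    refine integral_congr_ae (ae_of_all _ fun t => ?_)
    by_cases ht : t ∈ U
    · simp [ContinuousLinearMap.precompL_apply, ht, hgrad, mul_comm]
    · simp [ht]
  have e2 : ∫ t, (K (x - t) • U.indicator G t) i = ∫ y in U, G y i * K (x - y) := by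
    rw [← integral_indicator hU]
    refine integral_congr_ae (ae_of_all _ fun t => ?_)
    by_cases ht : t ∈ U
    · simp [ht, mul_comm]
    · simp [ht]
  rw [e1, e2, hweak, neg_neg]

/-- Local density of smooth functions in `H¹` (Meyers–Serrin on an interior ball). -/
theorem exists_smooth_tendsto {R r : ℝ} (hr : r < R)
    {f : EuclideanSpace ℝ (Fin n) → ℝ} {G : EuclideanSpace ℝ (Fin n) → EuclideanSpace ℝ (Fin n)}
    (hw : HasWeakGradient (Metric.ball 0 R) f G)
    (hf : MemLp f 2 (volume.restrict (Metric.ball 0 R)))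
    (hG : MemLp G 2 (volume.restrict (Metric.ball 0 R))) :
    ∃ u : ℕ → EuclideanSpace ℝ (Fin n) → ℝ, (∀ j, ContDiff ℝ ∞ (u j)) ∧
      Tendsto (fun j => eLpNorm (u j - f) 2 (volume.restrict (Metric.ball 0 r))) atTop (𝓝 0) ∧
      Tendsto (fun j => eLpNorm (gradient (u j) - G) 2 (volume.restrict (Metric.ball 0 r)))
        atTop (𝓝 0) := by
  set U : Set (EuclideanSpace ℝ (Fin n)) := Metric.ball 0 R
  have hU : MeasurableSet U := Metric.isOpen_ball.measurableSet
  have hf' : MemLp (U.indicator f) 2 volume := (memLp_indicator_iff_restrict hU).2 hf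
  have hG' : MemLp (U.indicator G) 2 volume := (memLp_indicator_iff_restrict hU).2 hG
  have hfl := hf'.locallyIntegrable (by norm_num)
  have hGl := hG'.locallyIntegrable (by norm_num)
  -- These mollification radii tend to zero and stay below `R - r`, so every ball used about a point
  -- of the ball of radius `r` remains in `U`.
  have hpos : ∀ j : ℕ, 0 < (R - r) / (j + 2) := fun j => div_pos (by linarith) (by positivity)
  let φ : ℕ → ContDiffBump (0 : EuclideanSpace ℝ (Fin n)) := fun j =>
    ⟨(R - r) / (j + 2) / 2, (R - r) / (j + 2), half_pos (hpos j), half_lt_self (hpos j)⟩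
  have hφ : Tendsto (fun j => (φ j).rOut) atTop (𝓝 0) := by
    refine Tendsto.div_atTop tendsto_const_nhds ?_
    exact tendsto_atTop_add_const_right _ _ tendsto_natCast_atTop_atTop
  have hsub : Metric.ball (0 : EuclideanSpace ℝ (Fin n)) r ⊆ U := Metric.ball_subset_ball hr.le
  have hfin : volume (Metric.ball (0 : EuclideanSpace ℝ (Fin n)) r) ≠ ⊤ :=
    measure_ball_lt_top.ne
  have hin : ∀ j, ∀ x ∈ Metric.ball (0 : EuclideanSpace ℝ (Fin n)) r,
      Metric.closedBall x (φ j).rOut ⊆ U := by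
    intro j x hx y hy
    have h1 : (φ j).rOut < R - r := by
      refine div_lt_self (by linarith) ?_
      have : (0 : ℝ) ≤ j := Nat.cast_nonneg j
      linarith
    have h2 := dist_triangle y x 0
    have h3 := Metric.mem_ball.1 hx
    have h4 := Metric.mem_closedBall.1 hy
    exact Metric.mem_ball.2 (by linarith)
  refine ⟨fun j => (φ j).normed volume ⋆[ContinuousLinearMap.lsmul ℝ ℝ, volume] U.indicator f,
    fun j => ?_, ?_, ?_⟩
  · exact (φ j).hasCompactSupport_normed.contDiff_convolution_left _ (φ j).contDiff_normed hfl
  · refine (tendsto_eLpNorm_normed_convolution_sub hφ hf' hfin).congr fun j => ?_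
    refine eLpNorm_congr_ae ?_
    filter_upwards [ae_restrict_mem Metric.isOpen_ball.measurableSet] with x hx
    simp [Set.indicator_of_mem (hsub hx)]
  · refine (tendsto_eLpNorm_normed_convolution_sub hφ hG' hfin).congr fun j => ?_
    refine eLpNorm_congr_ae ?_
    filter_upwards [ae_restrict_mem Metric.isOpen_ball.measurableSet] with x hx
    rw [Pi.sub_apply, Pi.sub_apply, gradient_normed_convolution hU hw hfl hGl (φ j) (hin j x hx),
      Set.indicator_of_mem (hsub hx)]

end Approximation

/-! ### A smooth ramp approximating the positive part. -/

section Ramp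

/-- A smooth approximation of `t ↦ max t 0`, with error at most `1 / m`. -/
noncomputable def smoothRamp (m t : ℝ) : ℝ := ∫ s in (0 : ℝ)..t, Real.smoothTransition (m * s)

theorem continuous_smoothTransition_mul (m : ℝ) :
    Continuous fun s : ℝ => Real.smoothTransition (m * s) :=
  Real.smoothTransition.continuous.comp (continuous_const.mul continuous_id)

theorem hasDerivAt_smoothRamp (m t : ℝ) :
    HasDerivAt (smoothRamp m) (Real.smoothTransition (m * t)) t :=
  intervalIntegral.integral_hasDerivAt_right
    ((continuous_smoothTransition_mul m).intervalIntegrable _ _)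
    (continuous_smoothTransition_mul m).aestronglyMeasurable.stronglyMeasurableAtFilter
    (continuous_smoothTransition_mul m).continuousAt

theorem deriv_smoothRamp (m : ℝ) :
    deriv (smoothRamp m) = fun t => Real.smoothTransition (m * t) :=
  funext fun t => (hasDerivAt_smoothRamp m t).deriv

theorem contDiff_smoothRamp (m : ℝ) : ContDiff ℝ ∞ (smoothRamp m) := by
  rw [contDiff_infty_iff_deriv, deriv_smoothRamp]
  exact ⟨fun t => (hasDerivAt_smoothRamp m t).differentiableAt,
    Real.smoothTransition.contDiff.comp (contDiff_const.mul contDiff_id)⟩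

theorem smoothRamp_of_nonpos {m t : ℝ} (hm : 0 < m) (ht : t ≤ 0) : smoothRamp m t = 0 := by
  rw [smoothRamp, intervalIntegral.integral_congr (g := fun _ => (0 : ℝ))]
  · simp
  · intro s hs
    rw [Set.uIcc_of_ge ht] at hs
    exact Real.smoothTransition.zero_of_nonpos (mul_nonpos_of_nonneg_of_nonpos hm.le hs.2)

theorem smoothRamp_nonneg {m : ℝ} (hm : 0 < m) (t : ℝ) : 0 ≤ smoothRamp m t := by
  rcases le_total t 0 with ht | ht
  · exact (smoothRamp_of_nonpos hm ht).ge
  · exact intervalIntegral.integral_nonneg ht fun s _ => Real.smoothTransition.nonneg _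

theorem abs_smoothRamp_sub_le (m a b : ℝ) : |smoothRamp m a - smoothRamp m b| ≤ |a - b| := by
  rw [smoothRamp, smoothRamp, intervalIntegral.integral_interval_sub_left
    ((continuous_smoothTransition_mul m).intervalIntegrable _ _)
    ((continuous_smoothTransition_mul m).intervalIntegrable _ _)]
  have := intervalIntegral.norm_integral_le_of_norm_le_const (a := b) (b := a) (C := 1)
    (f := fun s => Real.smoothTransition (m * s)) fun s _ => by
      rw [Real.norm_of_nonneg (Real.smoothTransition.nonneg _)]
      exact Real.smoothTransition.le_one _
  simpa using this

theorem abs_smoothRamp_sub_max_le {m : ℝ} (hm : 0 < m) (t : ℝ) :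
    |smoothRamp m t - max t 0| ≤ 1 / m := by
  rcases le_total t 0 with ht | ht
  · rw [smoothRamp_of_nonpos hm ht, max_eq_right ht]; simp [hm.le]
  have h0 : smoothRamp m 0 = 0 := smoothRamp_of_nonpos hm le_rfl
  have hle : smoothRamp m t ≤ t := by
    have := abs_smoothRamp_sub_le m t 0
    rw [h0, sub_zero, sub_zero, abs_of_nonneg ht] at this
    exact (le_abs_self _).trans this
  have hnn := smoothRamp_nonneg hm t
  rw [max_eq_left ht, abs_sub_comm, abs_of_nonneg (by linarith)]
  rcases le_total t (1 / m) with h | h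
  · linarith
  -- Beyond `1 / m` the ramp has slope exactly one, so all of its deficit is created on `[0, 1 /
  -- m]`.
  have h1 : smoothRamp m t - smoothRamp m (1 / m) = t - 1 / m := by
    rw [smoothRamp, smoothRamp, intervalIntegral.integral_interval_sub_left
      ((continuous_smoothTransition_mul m).intervalIntegrable _ _)
      ((continuous_smoothTransition_mul m).intervalIntegrable _ _),
      intervalIntegral.integral_congr (g := fun _ => (1 : ℝ))]
    · simp
    · intro s hs
      rw [Set.uIcc_of_le h] at hs
      refine Real.smoothTransition.one_of_one_le ?_
      have := mul_le_mul_of_nonneg_left hs.1 hm.le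
      rwa [mul_one_div_cancel hm.ne'] at this
  have := smoothRamp_nonneg hm (1 / m)
  linarith

/-- The limit is the strict indicator at every `t`, including `t = 0`. Hence the truncated gradients
converge pointwise even on `{f = l}`, with no need to know that the gradient vanishes there. -/
theorem tendsto_smoothTransition_mul (t : ℝ) :
    Tendsto (fun m : ℕ => Real.smoothTransition ((m + 1 : ℝ) * t)) atTop
      (𝓝 (if 0 < t then 1 else 0)) := by
  split_ifs with ht
  · refine tendsto_const_nhds.congr' ?_
    obtain ⟨N, hN⟩ := exists_nat_gt (1 / t)
    filter_upwards [eventually_ge_atTop N] with m hm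
    refine (Real.smoothTransition.one_of_one_le ?_).symm
    have h1 : 1 / t < (m : ℝ) + 1 := by
      have : (N : ℝ) ≤ m := by exact_mod_cast hm
      linarith
    exact ((div_lt_iff₀ ht).1 h1).le
  · refine tendsto_const_nhds.congr fun m => ?_
    refine (Real.smoothTransition.zero_of_nonpos ?_).symm
    exact mul_nonpos_of_nonneg_of_nonpos (by positivity) (not_lt.1 ht)

end Ramp

/-! ### Dominated convergence in `L²`. -/

section Convergence
variable {α F : Type*} [MeasurableSpace α] {μ : Measure α} [NormedAddCommGroup F] [NormedSpace ℝ F]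

/-- Dominated convergence with majorant `‖G‖²`. -/
theorem tendsto_eLpNorm_smul_zero {G : α → F} (hG : MemLp G 2 μ) {c : ℕ → α → ℝ}
    (hc : ∀ j, AEStronglyMeasurable (c j) μ) (hb : ∀ j x, |c j x| ≤ 1)
    (hlim : ∀ᵐ x ∂μ, Tendsto (fun j => c j x) atTop (𝓝 0)) :
    Tendsto (fun j => eLpNorm (fun x => c j x • G x) 2 μ) atTop (𝓝 0) := by
  have key : Tendsto (fun j => ∫⁻ x, ‖c j x • G x‖ₑ ^ (2 : ℝ) ∂μ) atTop (𝓝 (∫⁻ _, 0 ∂μ)) := by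
    refine tendsto_lintegral_of_dominated_convergence' (fun x => ‖G x‖ₑ ^ (2 : ℝ))
      (fun j => ((hc j).smul hG.1).enorm.pow_const _) (fun j => ae_of_all _ fun x => ?_) ?_ ?_
    · refine ENNReal.rpow_le_rpow ?_ (by norm_num)
      rw [enorm_smul]
      refine mul_le_of_le_one_left zero_le ?_
      rw [Real.enorm_eq_ofReal_abs, ENNReal.ofReal_le_one]
      exact hb j x
    · rw [← eLpNorm_two_rpow]
      exact ENNReal.rpow_ne_top_of_nonneg (by norm_num) hG.2.ne
    · filter_upwards [hlim] with x hx
      have h1 : Tendsto (fun j => c j x • G x) atTop (𝓝 0) := by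
        simpa using hx.smul_const (G x)
      have h2 : Tendsto (fun j => ‖c j x • G x‖ₑ) atTop (𝓝 0) := by
        simpa using h1.enorm
      simpa using h2.ennrpow_const 2
  have h := (key.ennrpow_const (1 / 2 : ℝ))
  simp only [lintegral_zero] at h
  rw [ENNReal.zero_rpow_of_pos (by norm_num)] at h
  refine h.congr fun j => ?_
  rw [← eLpNorm_two_rpow, ← ENNReal.rpow_mul]
  norm_num

end Convergence

/-! ### Truncation of strong `L²` limits. -/

section Truncation
variable {E : Type*} [NormedAddCommGroup E] [InnerProductSpace ℝ E] [FiniteDimensional ℝ E]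
  [MeasurableSpace E] [BorelSpace E] {μ : Measure E}

/-- The chain rule for strong `L²` limits of smooth functions. -/
theorem exists_smoothRamp_comp_close {u : ℕ → E → ℝ} {f : E → ℝ} {G : E → E}
    (hu : ∀ j, ContDiff ℝ ∞ (u j)) (hf : AEStronglyMeasurable f μ) (hG : MemLp G 2 μ)
    (huf : Tendsto (fun j => eLpNorm (u j - f) 2 μ) atTop (𝓝 0))
    (huG : Tendsto (fun j => eLpNorm (gradient (u j) - G) 2 μ) atTop (𝓝 0))
    (l : ℝ) {m : ℝ} (hm : 0 < m) {ε : ℝ≥0∞} (hε : 0 < ε) :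
    ∃ v : E → ℝ, ContDiff ℝ ∞ v ∧ (∀ x, 0 ≤ v x) ∧
      eLpNorm (fun x => v x - smoothRamp m (f x - l)) 2 μ ≤ ε ∧
      eLpNorm (fun x => gradient v x - Real.smoothTransition (m * (f x - l)) • G x) 2 μ ≤ ε := by
  have hgc : ∀ j, Continuous (gradient (u j)) := fun j =>
    continuous_gradient ((hu j).of_le (by exact_mod_cast le_top))
  -- Along a subsequence `u j → f` almost everywhere, so the derivatives of the ramp at `u j`
  -- converge almost everywhere as well.
  obtain ⟨ns, hns, hae⟩ := (tendstoInMeasure_of_tendsto_eLpNorm (by norm_num)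
    (fun j => (hu j).continuous.aestronglyMeasurable) hf huf).exists_seq_tendsto_ae
  have hcont : Continuous fun t => Real.smoothTransition (m * (t - l)) :=
    (continuous_smoothTransition_mul m).comp (continuous_id.sub continuous_const)
  let c : ℕ → E → ℝ := fun j x => Real.smoothTransition (m * (u (ns j) x - l)) -
    Real.smoothTransition (m * (f x - l))
  have hcm : ∀ j, AEStronglyMeasurable (c j) μ := fun j =>
    (hcont.comp (hu (ns j)).continuous).aestronglyMeasurable.sub
      (hcont.comp_aestronglyMeasurable hf)
  have hc0 : Tendsto (fun j => eLpNorm (fun x => c j x • G x) 2 μ) atTop (𝓝 0) := by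
    refine tendsto_eLpNorm_smul_zero hG hcm (fun j x => ?_) ?_
    · rw [abs_le]
      have h1 := Real.smoothTransition.nonneg (m * (u (ns j) x - l))
      have h2 := Real.smoothTransition.le_one (m * (u (ns j) x - l))
      have h3 := Real.smoothTransition.nonneg (m * (f x - l))
      have h4 := Real.smoothTransition.le_one (m * (f x - l))
      constructor <;> linarith
    · filter_upwards [hae] with x hx
      have := (((hcont.tendsto (f x)).comp hx).sub_const (Real.smoothTransition (m * (f x - l))))
      simpa using this
  have hsum := (huG.comp hns.tendsto_atTop).add hc0
  rw [add_zero] at hsum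
  obtain ⟨j, hj1, hj2⟩ := ((ENNReal.tendsto_nhds_zero.1 (huf.comp hns.tendsto_atTop) ε hε).and
    (ENNReal.tendsto_nhds_zero.1 hsum ε hε)).exists
  refine ⟨fun x => smoothRamp m (u (ns j) x - l),
    (contDiff_smoothRamp m).comp ((hu (ns j)).sub contDiff_const),
    fun x => smoothRamp_nonneg hm _, ?_, ?_⟩
  · refine (eLpNorm_mono fun x => ?_).trans hj1
    have := abs_smoothRamp_sub_le m (u (ns j) x - l) (f x - l)
    rwa [sub_sub_sub_cancel_right] at this
  · refine le_trans ?_ hj2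
    have hgr : ∀ x, gradient (fun x => smoothRamp m (u (ns j) x - l)) x =
        Real.smoothTransition (m * (u (ns j) x - l)) • gradient (u (ns j)) x := by
      intro x
      have hd : DifferentiableAt ℝ (u (ns j)) x := (hu _).differentiable (by simp) x
      have h1 : HasDerivAt (fun t => smoothRamp m (t - l))
          (Real.smoothTransition (m * (u (ns j) x - l))) (u (ns j) x) :=
        (hasDerivAt_smoothRamp m _).comp_sub_const _ _
      rw [gradient_comp_real (β := fun t => smoothRamp m (t - l)) h1.differentiableAt hd, h1.deriv]
    -- With `β` the shifted ramp: `β'(u)∇u - β'(f)G = β'(u)(∇u - G) + (β'(u) - β'(f))G`. The first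
    -- term is small since `0 ≤ β' ≤ 1`, the second by dominated convergence.
    have hsplit : (fun x => gradient (fun x => smoothRamp m (u (ns j) x - l)) x -
        Real.smoothTransition (m * (f x - l)) • G x) =
        (fun x => Real.smoothTransition (m * (u (ns j) x - l)) • (gradient (u (ns j)) x - G x)) +
          fun x => c j x • G x := by
      funext x
      simp only [hgr, Pi.add_apply, c, smul_sub, sub_smul]
      abel
    rw [hsplit]
    refine (eLpNorm_add_le ?_ ((hcm j).smul hG.1) (by norm_num)).trans (add_le_add ?_ le_rfl)
    · exact (hcont.comp (hu (ns j)).continuous).aestronglyMeasurable.smul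
        ((hgc _).aestronglyMeasurable.sub hG.1)
    · refine eLpNorm_mono fun x => ?_
      rw [norm_smul, Real.norm_of_nonneg (Real.smoothTransition.nonneg _)]
      exact mul_le_of_le_one_left (norm_nonneg _) (Real.smoothTransition.le_one _)

/-- The positive part of a strong `L²` limit of smooth functions is again such a limit, with
nonnegative approximants, and its gradient is the truncated gradient. -/
theorem exists_smooth_tendsto_posPart [IsFiniteMeasure μ] {u : ℕ → E → ℝ} {f : E → ℝ} {G : E → E}
    (hu : ∀ j, ContDiff ℝ ∞ (u j)) (hf : AEStronglyMeasurable f μ) (hG : MemLp G 2 μ)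
    (huf : Tendsto (fun j => eLpNorm (u j - f) 2 μ) atTop (𝓝 0))
    (huG : Tendsto (fun j => eLpNorm (gradient (u j) - G) 2 μ) atTop (𝓝 0)) (l : ℝ) :
    ∃ v : ℕ → E → ℝ, (∀ j, ContDiff ℝ ∞ (v j)) ∧ (∀ j x, 0 ≤ v j x) ∧
      Tendsto (fun j => eLpNorm (fun x => v j x - max (f x - l) 0) 2 μ) atTop (𝓝 0) ∧
      Tendsto (fun j => eLpNorm (fun x => gradient (v j) x -
        (if l < f x then (1 : ℝ) else 0) • G x) 2 μ) atTop (𝓝 0) := by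
  have hmp : ∀ m : ℕ, (0 : ℝ) < m + 1 := fun m => by positivity
  have hεp : ∀ m : ℕ, (0 : ℝ≥0∞) < ((m : ℝ≥0∞) + 1)⁻¹ := fun m => by
    rw [ENNReal.inv_pos]; simp
  -- Diagonal choice: the ramp sharpens, with parameter `m + 1`, while the approximation error is at
  -- most `1 / (m + 1)`.
  choose v hv hv0 hv1 hv2 using fun m : ℕ =>
    exists_smoothRamp_comp_close hu hf hG huf huG l (hmp m) (hεp m)
  have hε0 : Tendsto (fun m : ℕ => ((m : ℝ≥0∞) + 1)⁻¹) atTop (𝓝 0) := by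
    have := (ENNReal.tendsto_inv_nat_nhds_zero).comp (tendsto_add_atTop_nat 1)
    refine this.congr fun m => ?_
    simp
  have hfl : AEStronglyMeasurable (fun x => f x - l) μ := hf.sub aestronglyMeasurable_const
  have hmaxm : AEStronglyMeasurable (fun x => max (f x - l) 0) μ :=
    (continuous_id.max continuous_const).comp_aestronglyMeasurable hfl
  have hrm : ∀ m : ℕ, AEStronglyMeasurable (fun x => smoothRamp (m + 1 : ℝ) (f x - l)) μ :=
    fun m => (contDiff_smoothRamp _).continuous.comp_aestronglyMeasurable hfl
  have htm : ∀ m : ℕ, AEStronglyMeasurable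
      (fun x => Real.smoothTransition ((m + 1 : ℝ) * (f x - l))) μ :=
    fun m => (continuous_smoothTransition_mul _).comp_aestronglyMeasurable hfl
  have hif : AEStronglyMeasurable (fun x => if l < f x then (1 : ℝ) else 0) μ := by
    have : Measurable fun t : ℝ => if l < t then (1 : ℝ) else 0 :=
      Measurable.ite measurableSet_Ioi measurable_const measurable_const
    exact (this.comp_aemeasurable hf.aemeasurable).aestronglyMeasurable
  refine ⟨v, hv, hv0, ?_, ?_⟩
  · have h1 : Tendsto (fun m : ℕ => eLpNorm (fun x => smoothRamp (m + 1 : ℝ) (f x - l) -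
        max (f x - l) 0) 2 μ) atTop (𝓝 0) := by
      have h2 : Tendsto (fun m : ℕ => μ Set.univ ^ (1 / 2 : ℝ) * ENNReal.ofReal (1 / (m + 1 : ℝ)))
          atTop (𝓝 0) := by
        have h3 : Tendsto (fun m : ℕ => ENNReal.ofReal (1 / (m + 1 : ℝ))) atTop (𝓝 0) := by
          simpa using ENNReal.tendsto_ofReal (tendsto_one_div_add_atTop_nhds_zero_nat (𝕜 := ℝ))
        simpa using ENNReal.Tendsto.const_mul h3
          (Or.inr (ENNReal.rpow_ne_top_of_nonneg (by norm_num) (measure_ne_top μ _)))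
      refine tendsto_of_tendsto_of_tendsto_of_le_of_le tendsto_const_nhds h2
        (fun _ => zero_le) fun m => ?_
      refine (eLpNorm_le_of_ae_bound (C := 1 / (m + 1 : ℝ)) (ae_of_all _ fun x => ?_)).trans ?_
      · exact abs_smoothRamp_sub_max_le (hmp m) _
      · simp
    have h2 := hε0.add h1
    rw [add_zero] at h2
    refine tendsto_of_tendsto_of_tendsto_of_le_of_le tendsto_const_nhds h2
        (fun _ => zero_le) fun m => ?_
    refine le_trans ?_ (add_le_add (hv1 m) le_rfl)
    refine le_trans (le_of_eq ?_) (eLpNorm_add_le ((hv m).continuous.aestronglyMeasurable.sub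
      (hrm m)) ((hrm m).sub hmaxm) (by norm_num))
    congr 1
    funext x
    simp
  · have h1 : Tendsto (fun m : ℕ => eLpNorm (fun x =>
        (Real.smoothTransition ((m + 1 : ℝ) * (f x - l)) - if l < f x then (1 : ℝ) else 0) •
          G x) 2 μ) atTop (𝓝 0) := by
      refine tendsto_eLpNorm_smul_zero hG (fun m => (htm m).sub hif) (fun m x => ?_)
        (ae_of_all _ fun x => ?_)
      · have h1 := Real.smoothTransition.nonneg ((m + 1 : ℝ) * (f x - l))
        have h2 := Real.smoothTransition.le_one ((m + 1 : ℝ) * (f x - l))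
        rw [abs_le]
        split_ifs <;> constructor <;> linarith
      · have := (tendsto_smoothTransition_mul (f x - l)).sub_const
          (if l < f x then (1 : ℝ) else 0)
        simpa [sub_pos] using this
    have h2 := hε0.add h1
    rw [add_zero] at h2
    refine tendsto_of_tendsto_of_tendsto_of_le_of_le tendsto_const_nhds h2
        (fun _ => zero_le) fun m => ?_
    refine le_trans ?_ (add_le_add (hv2 m) le_rfl)
    refine le_trans (le_of_eq ?_) (eLpNorm_add_le ((continuous_gradient ((hv m).of_le
      (by exact_mod_cast le_top))).aestronglyMeasurable.sub
      ((htm m).smul hG.1)) (((htm m).sub hif).smul hG.1) (by norm_num))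
    congr 1
    funext x
    simp [sub_smul]

end Truncation

/-! ### Passing to strong `L²` limits in pairings and in products with cutoffs. -/

section Limits
variable {E : Type*} [NormedAddCommGroup E] [InnerProductSpace ℝ E]

theorem memLp_two_integrable_inner {α : Type*} [MeasurableSpace α] {μ : Measure α} {f g : α → E}
    (hf : MemLp f 2 μ) (hg : MemLp g 2 μ) : Integrable (fun x => inner ℝ (f x) (g x)) μ := by
  refine memLp_one_iff_integrable.1 (MemLp.of_bilin (p := 2) (q := 2) (fun a b => inner ℝ a b) 1
    hf hg (hf.1.inner hg.1) (ae_of_all μ fun x => ?_))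
  simpa using nnnorm_inner_le_nnnorm (𝕜 := ℝ) (f x) (g x)

theorem tendsto_integral_inner {α : Type*} [MeasurableSpace α] {μ : Measure α} {H ψ : α → E}
    {ψs : ℕ → α → E} (hH : MemLp H 2 μ) (hψs : ∀ j, MemLp (ψs j) 2 μ) (hψ : MemLp ψ 2 μ)
    (h : Tendsto (fun j => eLpNorm (fun x => ψs j x - ψ x) 2 μ) atTop (𝓝 0)) :
    Tendsto (fun j => ∫ x, inner ℝ (H x) (ψs j x) ∂μ) atTop (𝓝 (∫ x, inner ℝ (H x) (ψ x) ∂μ)) := by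
  rw [tendsto_iff_edist_tendsto_0]
  have h1 : Tendsto (fun j => eLpNorm H 2 μ * eLpNorm (fun x => ψs j x - ψ x) 2 μ) atTop (𝓝 0) := by
    simpa using ENNReal.Tendsto.const_mul h (Or.inr hH.2.ne)
  refine tendsto_of_tendsto_of_tendsto_of_le_of_le tendsto_const_nhds h1
    (fun _ => zero_le) fun j => ?_
  rw [edist_eq_enorm_sub, ← integral_sub (memLp_two_integrable_inner hH (hψs j))
    (memLp_two_integrable_inner hH hψ)]
  refine (enorm_integral_le_lintegral_enorm _).trans ?_
  have h2 := eLpNorm_le_eLpNorm_mul_eLpNorm'_of_norm (p := 2) (q := 2) (r := 1) hH.1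
    ((hψs j).1.sub hψ.1) (fun a b => inner ℝ a b) 1 (ae_of_all μ fun x => by
      simpa using norm_inner_le_norm (𝕜 := ℝ) (H x) ((ψs j - ψ) x))
  rw [eLpNorm_one_eq_lintegral_enorm] at h2
  refine le_trans (le_of_eq ?_) (h2.trans (le_of_eq ?_))
  · refine lintegral_congr fun x => ?_
    simp [inner_sub_right]
  · simp [Pi.sub_def]

variable [FiniteDimensional ℝ E] [MeasurableSpace E] [BorelSpace E] {μ : Measure E}

/-- The product rule for strong `L²` limits of smooth functions. -/
theorem tendsto_eLpNorm_gradient_mul {ζ : E → ℝ} (hζ : ContDiff ℝ ∞ ζ) (hζc : HasCompactSupport ζ)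
    {v : ℕ → E → ℝ} (hv : ∀ j, ContDiff ℝ ∞ (v j)) {w : E → ℝ} {F : E → E}
    (hw : AEStronglyMeasurable w μ) (hF : AEStronglyMeasurable F μ)
    (h0 : Tendsto (fun j => eLpNorm (fun x => v j x - w x) 2 μ) atTop (𝓝 0))
    (h1 : Tendsto (fun j => eLpNorm (fun x => gradient (v j) x - F x) 2 μ) atTop (𝓝 0)) :
    Tendsto (fun j => eLpNorm (fun x => gradient (fun y => ζ y * v j y) x -
      (ζ x • F x + w x • gradient ζ x)) 2 μ) atTop (𝓝 0) := by
  have h1le : (1 : WithTop ℕ∞) ≤ ((⊤ : ℕ∞) : WithTop ℕ∞) := by exact_mod_cast le_top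
  have hgζ : Continuous (gradient ζ) := continuous_gradient (hζ.of_le h1le)
  obtain ⟨M, hM⟩ := hζc.exists_bound_of_continuous hζ.continuous
  obtain ⟨N, hN⟩ := (hζc.fderiv ℝ).exists_bound_of_continuous
    ((hζ.of_le h1le).continuous_fderiv one_ne_zero)
  have hlim : Tendsto (fun j => ENNReal.ofReal M * eLpNorm (fun x => gradient (v j) x - F x) 2 μ +
      ENNReal.ofReal N * eLpNorm (fun x => v j x - w x) 2 μ) atTop (𝓝 0) := by
    have a1 := ENNReal.Tendsto.const_mul h1 (Or.inr (ENNReal.ofReal_ne_top (r := M)))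
    have a2 := ENNReal.Tendsto.const_mul h0 (Or.inr (ENNReal.ofReal_ne_top (r := N)))
    simpa using a1.add a2
  refine tendsto_of_tendsto_of_tendsto_of_le_of_le tendsto_const_nhds hlim
    (fun _ => zero_le) fun j => ?_
  have hsplit : (fun x => gradient (fun y => ζ y * v j y) x -
      (ζ x • F x + w x • gradient ζ x)) =
      (fun x => ζ x • (gradient (v j) x - F x)) + fun x => (v j x - w x) • gradient ζ x := by
    funext x
    rw [gradient_mul ((hζ.differentiable (by simp)) x) (((hv j).differentiable (by simp)) x)]
    simp only [Pi.add_apply, smul_sub, sub_smul]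
    abel
  rw [hsplit]
  have hgv : Continuous (gradient (v j)) := continuous_gradient ((hv j).of_le h1le)
  refine (eLpNorm_add_le (hζ.continuous.aestronglyMeasurable.smul
    (hgv.aestronglyMeasurable.sub hF)) (((hv j).continuous.aestronglyMeasurable.sub hw).smul
      hgζ.aestronglyMeasurable) (by norm_num)).trans (add_le_add ?_ ?_)
  · refine eLpNorm_le_mul_eLpNorm_of_ae_le_mul (ae_of_all _ fun x => ?_) 2
    rw [Pi.smul_apply', norm_smul]
    exact mul_le_mul_of_nonneg_right (hM x) (norm_nonneg _)
  · refine eLpNorm_le_mul_eLpNorm_of_ae_le_mul (ae_of_all _ fun x => ?_) 2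
    rw [Pi.smul_apply', norm_smul, mul_comm, norm_gradient_eq]
    exact mul_le_mul_of_nonneg_right (hN x) (norm_nonneg _)

theorem memLp_smul_of_hasCompactSupport {F' : Type*} [NormedAddCommGroup F'] [NormedSpace ℝ F']
    {ζ : E → ℝ} (hζ : Continuous ζ) (hζc : HasCompactSupport ζ)
    {w : E → F'} (hw : MemLp w 2 μ) : MemLp (fun x => ζ x • w x) 2 μ := by
  obtain ⟨M, hM⟩ := hζc.exists_bound_of_continuous hζ
  refine MemLp.of_le_mul (c := M) hw (hζ.aestronglyMeasurable.smul hw.1) (ae_of_all _ fun x => ?_)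
  rw [norm_smul]
  exact mul_le_mul_of_nonneg_right (hM x) (norm_nonneg _)

theorem hasCompactSupport_gradient {ζ : E → ℝ} (hζc : HasCompactSupport ζ) :
    HasCompactSupport (gradient ζ) :=
  (hζc.fderiv ℝ).comp_left (g := (InnerProductSpace.toDual ℝ E).symm) (map_zero _)

theorem memLp_smul_gradient {ζ : E → ℝ} (hζ : ContDiff ℝ ∞ ζ) (hζc : HasCompactSupport ζ)
    {w : E → ℝ} (hw : MemLp w 2 μ) : MemLp (fun x => w x • gradient ζ x) 2 μ := by
  have hgζ : Continuous (gradient ζ) := continuous_gradient (hζ.of_le (by exact_mod_cast le_top))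
  obtain ⟨M, hM⟩ := (hasCompactSupport_gradient hζc).exists_bound_of_continuous hgζ
  refine MemLp.of_le_mul (c := M) hw (hw.1.smul hgζ.aestronglyMeasurable) (ae_of_all _ fun x => ?_)
  rw [norm_smul, mul_comm]
  exact mul_le_mul_of_nonneg_right (hM x) (norm_nonneg _)

end Limits

/-! ### Ellipticity and the Caccioppoli inequality. -/

section Elliptic
variable {n : ℕ}

/-- Nonnegativity of the form at `a - b` gives `2⟨Ta, b⟩ ≤ Λ(‖a‖² + ‖b‖²)`; then take `b = Λ⁻¹ T a`.
This puts the flux `A ∇f` in `L²`. -/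
theorem norm_sq_smul_le {E : Type*} [NormedAddCommGroup E] [InnerProductSpace ℝ E]
    {T : E →ₗ[ℝ] E} (hT : T.IsSymmetric) {Λ : ℝ} (hΛ : 0 < Λ)
    (h0 : ∀ ξ, 0 ≤ inner ℝ (T ξ) ξ) (h : ∀ ξ, inner ℝ (T ξ) ξ ≤ Λ * ‖ξ‖ ^ 2) (a : E) :
    ‖T a‖ ≤ Λ * ‖a‖ := by
  have key : ∀ b, 2 * inner ℝ (T a) b ≤ Λ * (‖a‖ ^ 2 + ‖b‖ ^ 2) := by
    intro b
    have h1 := h0 (a - b)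
    have h2 := h a
    have h3 := h b
    have h4 : inner ℝ (T b) a = inner ℝ (T a) b := by rw [hT, real_inner_comm]
    rw [map_sub, inner_sub_left, inner_sub_right, inner_sub_right, h4] at h1
    linarith
  have h1 := key (Λ⁻¹ • T a)
  rw [inner_smul_right, real_inner_self_eq_norm_sq, norm_smul, Real.norm_of_nonneg
    (inv_nonneg.2 hΛ.le), mul_pow] at h1
  have h2 : ‖T a‖ ^ 2 ≤ (Λ * ‖a‖) ^ 2 := by
    have h3 : Λ * (2 * (Λ⁻¹ * ‖T a‖ ^ 2)) ≤ Λ * (Λ * (‖a‖ ^ 2 + Λ⁻¹ ^ 2 * ‖T a‖ ^ 2)) :=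
      mul_le_mul_of_nonneg_left h1 hΛ.le
    have h4 : Λ * (2 * (Λ⁻¹ * ‖T a‖ ^ 2)) = 2 * ‖T a‖ ^ 2 := by field_simp
    have h5 : Λ * (Λ * (‖a‖ ^ 2 + Λ⁻¹ ^ 2 * ‖T a‖ ^ 2)) = Λ ^ 2 * ‖a‖ ^ 2 + ‖T a‖ ^ 2 := by
      field_simp
    rw [h4, h5] at h3
    rw [mul_pow]
    linarith
  exact (pow_le_pow_iff_left₀ (norm_nonneg _) (by positivity) two_ne_zero).1 h2

/-- Nonnegativity of the form at `a + 4b`, divided by four, absorbs the cross term into a quarter of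
`⟨Ta, a⟩` at the price of `4⟨Tb, b⟩`. -/
theorem le_inner_add_two_inner {E : Type*} [NormedAddCommGroup E] [InnerProductSpace ℝ E]
    {T : E →ₗ[ℝ] E} (hT : T.IsSymmetric) {Λ : ℝ}
    (h0 : ∀ ξ, 0 ≤ inner ℝ (T ξ) ξ) (hl : ∀ ξ, Λ⁻¹ * ‖ξ‖ ^ 2 ≤ inner ℝ (T ξ) ξ)
    (h : ∀ ξ, inner ℝ (T ξ) ξ ≤ Λ * ‖ξ‖ ^ 2) (a b : E) :
    3 / 4 * (Λ⁻¹ * ‖a‖ ^ 2) - 4 * (Λ * ‖b‖ ^ 2) ≤ inner ℝ (T a) a + 2 * inner ℝ (T a) b := by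
  have h1 := h0 (a + (4 : ℝ) • b)
  have h2 := hl a
  have h3 := h b
  have h4 : inner ℝ (T b) a = inner ℝ (T a) b := by rw [hT, real_inner_comm]
  simp only [map_add, map_smul, inner_add_left, inner_add_right, inner_smul_left, inner_smul_right,
    h4] at h1
  simp only [conj_trivial] at h1
  linarith

theorem isSymmetric_toEuclideanLin {M : Matrix (Fin n) (Fin n) ℝ} (hM : M.IsSymm) :
    (Matrix.toEuclideanLin M).IsSymmetric := by
  rw [Matrix.isSymmetric_toEuclideanLin_iff]
  rwa [Matrix.IsHermitian, Matrix.conjTranspose_eq_transpose_of_trivial]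

theorem IsUniformlyElliptic.memLp_flux {U : Set (EuclideanSpace ℝ (Fin n))} {Λ : ℝ} (hΛ : 0 < Λ)
    {A : EuclideanSpace ℝ (Fin n) → Matrix (Fin n) (Fin n) ℝ} (hA : IsUniformlyElliptic U Λ A)
    {G : EuclideanSpace ℝ (Fin n) → EuclideanSpace ℝ (Fin n)}
    (hG : MemLp G 2 (volume.restrict U)) :
    MemLp (fun x => Matrix.toEuclideanLin (A x) (G x)) 2 (volume.restrict U) := by
  refine MemLp.of_le_mul (c := Λ) hG ?_ ?_
  · have hpi : AEMeasurable (fun x => fun i => ∑ j, A x i j * G x j) (volume.restrict U) := by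
      refine aemeasurable_pi_lambda _ fun i => ?_
      refine Finset.aemeasurable_fun_sum _ fun j _ => (hA.aemeasurable i j).mul ?_
      exact (EuclideanSpace.proj (𝕜 := ℝ) j).measurable.comp_aemeasurable hG.1.aemeasurable
    have := (PiLp.continuous_toLp 2 (fun _ : Fin n => ℝ)).measurable.comp_aemeasurable hpi
    refine this.aestronglyMeasurable.congr (ae_of_all _ fun x => ?_)
    ext i
    simp [Matrix.toEuclideanLin, Matrix.mulVec, dotProduct]
  · filter_upwards [hA.isSymm, hA.bounds] with x hs hb
    refine norm_sq_smul_le (isSymmetric_toEuclideanLin hs) hΛ (fun ξ => ?_) (fun ξ => (hb ξ).2) _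
    exact le_trans (by positivity) (hb ξ).1

theorem memLp_posPart_sub {α : Type*} [MeasurableSpace α] {μ : Measure α} [IsFiniteMeasure μ]
    {f : α → ℝ} (hf : MemLp f 2 μ) (l : ℝ) : MemLp (fun x => max (f x - l) 0) 2 μ := by
  have hsub : MemLp (fun x => f x - l) 2 μ := hf.sub (memLp_const l)
  refine hsub.mono ((continuous_id.max continuous_const).comp_aestronglyMeasurable hsub.1)
    (ae_of_all _ fun x => ?_)
  rw [Real.norm_of_nonneg (le_max_right _ _)]
  exact max_le (le_abs_self _) (abs_nonneg _)

theorem memLp_truncated {α F : Type*} [MeasurableSpace α] {μ : Measure α}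
    [NormedAddCommGroup F] [NormedSpace ℝ F]
    {f : α → ℝ} (hf : AEStronglyMeasurable f μ) {G : α → F} (hG : MemLp G 2 μ) (l : ℝ) :
    MemLp (fun x => (if l < f x then (1 : ℝ) else 0) • G x) 2 μ := by
  have : Measurable fun t : ℝ => if l < t then (1 : ℝ) else 0 :=
    Measurable.ite measurableSet_Ioi measurable_const measurable_const
  refine hG.mono ((this.comp_aemeasurable hf.aemeasurable).aestronglyMeasurable.smul hG.1)
    (ae_of_all _ fun x => ?_)
  split_ifs <;> simp

/-- Testing the subsolution inequality with `η² w`, where `w` is a strong limit of nonnegative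
smooth functions. -/
theorem integral_inner_sq_mul_le_zero {r R : ℝ} (hr : r ≤ R)
    {H : EuclideanSpace ℝ (Fin n) → EuclideanSpace ℝ (Fin n)}
    (hH : MemLp H 2 (volume.restrict (Metric.ball 0 R)))
    (hsub : ∀ φ : EuclideanSpace ℝ (Fin n) → ℝ, IsTestFunction (Metric.ball 0 R) φ →
      (∀ x, 0 ≤ φ x) → ∫ x in Metric.ball 0 R, inner ℝ (H x) (gradient φ x) ≤ 0)
    {η : EuclideanSpace ℝ (Fin n) → ℝ} (hη : IsTestFunction (Metric.ball 0 r) η)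
    {v : ℕ → EuclideanSpace ℝ (Fin n) → ℝ} (hv : ∀ j, ContDiff ℝ ∞ (v j)) (hv0 : ∀ j x, 0 ≤ v j x)
    {w : EuclideanSpace ℝ (Fin n) → ℝ} {F : EuclideanSpace ℝ (Fin n) → EuclideanSpace ℝ (Fin n)}
    (hw : MemLp w 2 (volume.restrict (Metric.ball 0 r)))
    (hF : MemLp F 2 (volume.restrict (Metric.ball 0 r)))
    (h0 : Tendsto (fun j => eLpNorm (fun x => v j x - w x) 2
      (volume.restrict (Metric.ball 0 r))) atTop (𝓝 0))
    (h1 : Tendsto (fun j => eLpNorm (fun x => gradient (v j) x - F x) 2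
      (volume.restrict (Metric.ball 0 r))) atTop (𝓝 0)) :
    ∫ x in Metric.ball 0 r, inner ℝ (H x)
      (η x ^ 2 • F x + w x • (2 * η x) • gradient η x) ≤ 0 := by
  have h1le : (1 : WithTop ℕ∞) ≤ ((⊤ : ℕ∞) : WithTop ℕ∞) := by exact_mod_cast le_top
  have hballs : Metric.ball (0 : EuclideanSpace ℝ (Fin n)) r ⊆ Metric.ball 0 R :=
    Metric.ball_subset_ball hr
  set ζ : EuclideanSpace ℝ (Fin n) → ℝ := fun x => η x * η x with hζdef
  have hζ : ContDiff ℝ ∞ ζ := hη.contDiff.mul hη.contDiff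
  have hζs : tsupport ζ ⊆ tsupport η := tsupport_mul_subset_left
  have hζc : HasCompactSupport ζ := hη.hasCompactSupport.mul_left
  have hζgrad : ∀ x, gradient ζ x = (2 * η x) • gradient η x := fun x => by
    rw [hζdef, gradient_mul ((hη.contDiff.differentiable (by simp)) x)
      ((hη.contDiff.differentiable (by simp)) x), ← add_smul, two_mul]
  have hts : ∀ j, tsupport (fun y => ζ y * v j y) ⊆ Metric.ball 0 r := fun j =>
    (tsupport_mul_subset_left.trans hζs).trans hη.tsupport_subset
  have htest : ∀ j, IsTestFunction (Metric.ball 0 R) (fun y => ζ y * v j y) := fun j =>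
    ⟨hζ.mul (hv j), hζc.mul_right, (hts j).trans hballs⟩
  have hle : ∀ j, ∫ x in Metric.ball 0 r, inner ℝ (H x) (gradient (fun y => ζ y * v j y) x) ≤ 0 := by
    intro j
    refine le_trans (le_of_eq ?_) (hsub _ (htest j) fun x =>
      mul_nonneg (mul_self_nonneg _) (hv0 j x))
    -- The test function is supported in the smaller ball, so nothing is lost by integrating over
    -- that ball only.
    refine (setIntegral_eq_of_subset_of_forall_sdiff_eq_zero
      Metric.isOpen_ball.measurableSet hballs fun x hx => ?_).symm
    rw [gradient_eq_zero_of_notMem_tsupport (fun h => hx.2 (hts j h)), inner_zero_right]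
  have hlim := tendsto_eLpNorm_gradient_mul hζ hζc hv hw.1 hF.1 h0 h1
  have hψ : MemLp (fun x => ζ x • F x + w x • gradient ζ x) 2
      (volume.restrict (Metric.ball 0 r)) :=
    (memLp_smul_of_hasCompactSupport hζ.continuous hζc hF).add (memLp_smul_gradient hζ hζc hw)
  have hψj : ∀ j, MemLp (gradient (fun y => ζ y * v j y)) 2
      (volume.restrict (Metric.ball 0 r)) := fun j =>
    (continuous_gradient ((htest j).contDiff.of_le h1le)).memLp_of_hasCompactSupport
      (hasCompactSupport_gradient (htest j).hasCompactSupport)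
  have hmain := le_of_tendsto' (tendsto_integral_inner
    (hH.mono_measure (Measure.restrict_mono hballs le_rfl)) hψj hψ hlim) hle
  refine le_trans (le_of_eq ?_) hmain
  simp only [hζgrad]
  simp only [hζdef, pow_two]

/-- The Caccioppoli inequality for `(f - l)₊`. -/
theorem caccioppoli {r R Λ : ℝ} (hr : r < R) (hΛ : 0 < Λ)
    {A : EuclideanSpace ℝ (Fin n) → Matrix (Fin n) (Fin n) ℝ}
    (hA : IsUniformlyElliptic (Metric.ball 0 R) Λ A)
    {f : EuclideanSpace ℝ (Fin n) → ℝ} {G : EuclideanSpace ℝ (Fin n) → EuclideanSpace ℝ (Fin n)}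
    (hf : MemLp f 2 (volume.restrict (Metric.ball 0 R)))
    (hG : MemLp G 2 (volume.restrict (Metric.ball 0 R)))
    (hw : HasWeakGradient (Metric.ball 0 R) f G)
    (hsub : ∀ φ : EuclideanSpace ℝ (Fin n) → ℝ, IsTestFunction (Metric.ball 0 R) φ →
      (∀ x, 0 ≤ φ x) → ∫ x in Metric.ball 0 R,
        inner ℝ (Matrix.toEuclideanLin (A x) (G x)) (gradient φ x) ≤ 0)
    {η : EuclideanSpace ℝ (Fin n) → ℝ} (hη : IsTestFunction (Metric.ball 0 r) η) (l : ℝ) :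
    eLpNorm (fun x => η x • (if l < f x then (1 : ℝ) else 0) • G x) 2
      (volume.restrict (Metric.ball 0 r)) ≤
    ENNReal.ofReal (4 * Λ) * eLpNorm (fun x => max (f x - l) 0 • gradient η x) 2
      (volume.restrict (Metric.ball 0 r)) := by
  have hballs : Metric.ball (0 : EuclideanSpace ℝ (Fin n)) r ⊆ Metric.ball 0 R :=
    Metric.ball_subset_ball hr.le
  set μ : Measure (EuclideanSpace ℝ (Fin n)) := volume.restrict (Metric.ball 0 r) with hμ
  have hfin : IsFiniteMeasure μ := ⟨by simp [hμ, measure_ball_lt_top]⟩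
  have hmono : μ ≤ volume.restrict (Metric.ball 0 R) := Measure.restrict_mono hballs le_rfl
  have hfμ : MemLp f 2 μ := hf.mono_measure hmono
  have hGμ : MemLp G 2 μ := hG.mono_measure hmono
  obtain ⟨u, hu, huf, huG⟩ := exists_smooth_tendsto hr hw hf hG
  obtain ⟨v, hv, hv0, hvf, hvG⟩ := exists_smooth_tendsto_posPart hu hfμ.1 hGμ huf huG l
  have hw2 := memLp_posPart_sub hfμ l
  have hF2 := memLp_truncated hfμ.1 hGμ l
  have hH := hA.memLp_flux hΛ hG
  have htest := integral_inner_sq_mul_le_zero hr.le hH hsub hη hv hv0 hw2 hF2 hvf hvG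
  set a := fun x => η x • (if l < f x then (1 : ℝ) else 0) • G x with ha
  set b := fun x => max (f x - l) 0 • gradient η x with hb
  have ha2 : MemLp a 2 μ :=
    memLp_smul_of_hasCompactSupport hη.contDiff.continuous hη.hasCompactSupport hF2
  have hb2 : MemLp b 2 μ := memLp_smul_gradient hη.contDiff hη.hasCompactSupport hw2
  -- On `{f > l}` the right side is `⟨A a, a⟩ + 2⟨A a, b⟩`; elsewhere `a`, `b` and the right side
  -- all vanish.
  have hpt : ∀ᵐ x ∂μ, 3 / 4 * (Λ⁻¹ * ‖a x‖ ^ 2) - 4 * (Λ * ‖b x‖ ^ 2) ≤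
      inner ℝ (Matrix.toEuclideanLin (A x) (G x)) (η x ^ 2 •
        (if l < f x then (1 : ℝ) else 0) • G x + max (f x - l) 0 • (2 * η x) • gradient η x) := by
    have hs := ae_mono hmono hA.isSymm
    have hbd := ae_mono hmono hA.bounds
    filter_upwards [hs, hbd] with x hsx hbx
    by_cases hx : l < f x
    · have := le_inner_add_two_inner (isSymmetric_toEuclideanLin hsx)
        (fun ξ => le_trans (by positivity) (hbx ξ).1) (fun ξ => (hbx ξ).1) (fun ξ => (hbx ξ).2)
        (a x) (b x)
      refine this.trans (le_of_eq ?_)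
      simp only [ha, hb, hx, if_true, one_smul, map_smul, inner_add_right, inner_smul_left,
        inner_smul_right, conj_trivial]
      ring
    · have hz : max (f x - l) 0 = 0 := max_eq_right (by linarith [not_lt.1 hx])
      simp [ha, hb, hx, hz]
  have hint : Integrable (fun x => inner ℝ (Matrix.toEuclideanLin (A x) (G x)) (η x ^ 2 •
      (if l < f x then (1 : ℝ) else 0) • G x + max (f x - l) 0 • (2 * η x) • gradient η x)) μ := by
    refine memLp_two_integrable_inner (hH.mono_measure hmono) (MemLp.add ?_ ?_)
    · have := memLp_smul_of_hasCompactSupport hη.contDiff.continuous hη.hasCompactSupport ha2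
      refine (memLp_congr_ae (ae_of_all _ fun x => ?_)).1 this
      simp only [ha, smul_smul]
      ring_nf
    · have := (memLp_smul_of_hasCompactSupport hη.contDiff.continuous hη.hasCompactSupport
        hb2).const_smul (2 : ℝ)
      refine (memLp_congr_ae (ae_of_all _ fun x => ?_)).1 this
      simp only [hb, Pi.smul_apply, smul_smul]
      ring_nf
  have ha3 : Integrable (fun x => ‖a x‖ ^ 2) μ := ha2.integrable_norm_pow (by norm_num)
  have hb3 : Integrable (fun x => ‖b x‖ ^ 2) μ := hb2.integrable_norm_pow (by norm_num)
  have hI := (integral_mono_ae (((ha3.const_mul Λ⁻¹).const_mul (3 / 4)).sub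
    ((hb3.const_mul Λ).const_mul 4)) hint hpt).trans htest
  have hI2 : 3 / 4 * (Λ⁻¹ * ∫ x, ‖a x‖ ^ 2 ∂μ) - 4 * (Λ * ∫ x, ‖b x‖ ^ 2 ∂μ) ≤ 0 := by
    rw [← integral_const_mul, ← integral_const_mul, ← integral_const_mul, ← integral_const_mul,
      ← integral_sub ((ha3.const_mul Λ⁻¹).const_mul (3 / 4)) ((hb3.const_mul Λ).const_mul 4)]
    exact hI
  have hb0 : 0 ≤ ∫ x, ‖b x‖ ^ 2 ∂μ := integral_nonneg fun x => by positivity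
  -- The computation gives the factor `16/3 · Λ²`, rounded up to `(4Λ)²`.
  have hfinal : ∫ x, ‖a x‖ ^ 2 ∂μ ≤ (4 * Λ) ^ 2 * ∫ x, ‖b x‖ ^ 2 ∂μ := by
    have h1 := mul_le_mul_of_nonneg_left hI2 hΛ.le
    have h2 : Λ * (3 / 4 * (Λ⁻¹ * ∫ x, ‖a x‖ ^ 2 ∂μ) - 4 * (Λ * ∫ x, ‖b x‖ ^ 2 ∂μ)) =
      3 / 4 * (∫ x, ‖a x‖ ^ 2 ∂μ) - 4 * (Λ ^ 2 * ∫ x, ‖b x‖ ^ 2 ∂μ) := by field_simp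
    rw [h2, mul_zero] at h1
    nlinarith [mul_nonneg (sq_nonneg Λ) hb0]
  have hconv : ∀ {g : EuclideanSpace ℝ (Fin n) → EuclideanSpace ℝ (Fin n)}, MemLp g 2 μ →
      eLpNorm g 2 μ = ENNReal.ofReal (√(∫ x, ‖g x‖ ^ 2 ∂μ)) := fun hg => by
    rw [hg.eLpNorm_eq_integral_rpow_norm (by norm_num) (by norm_num), Real.sqrt_eq_rpow]
    simp
  rw [hconv ha2, hconv hb2, ← ENNReal.ofReal_mul (by positivity)]
  refine ENNReal.ofReal_le_ofReal ?_
  refine Real.sqrt_le_iff.2 ⟨by positivity, ?_⟩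
  rwa [mul_pow, Real.sq_sqrt hb0]

end Elliptic

/-! ### Sobolev inequalities. -/

/-- In dimension one the conjugate exponent degenerates. Here `|u| ≤ ∫ |u'|` pointwise, and the
support in the unit ball turns this sup bound into an `L²` bound. -/
theorem eLpNorm_two_le_of_dim_one {u : EuclideanSpace ℝ (Fin 1) → ℝ} (hu : ContDiff ℝ 1 u)
    (hc : HasCompactSupport u) (hs : tsupport u ⊆ Metric.ball 0 1) :
    eLpNorm u 2 volume ≤
      (volume (Metric.ball (0 : EuclideanSpace ℝ (Fin 1)) 1) ^ (1 / 2 : ℝ)).toNNReal *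
        eLpNorm (fderiv ℝ u) 1 volume := by
  let b : OrthonormalBasis (Fin 1) ℝ ℝ := (stdOrthonormalBasis ℝ ℝ).reindex (finCongr (by simp))
  let e : ℝ ≃ₗᵢ[ℝ] EuclideanSpace ℝ (Fin 1) := b.repr
  have he : MeasurePreserving e volume volume := b.measurePreserving_repr
  have hg : ContDiff ℝ 1 (u ∘ e) := hu.comp e.contDiff
  have hgc : HasCompactSupport (u ∘ e) := hc.comp_homeomorph e.toHomeomorph
  have hderiv : ∀ t, ‖deriv (u ∘ e) t‖ₑ ≤ ‖fderiv ℝ u (e t)‖ₑ := by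
    intro t
    have h1 : HasDerivAt (u ∘ e) (fderiv ℝ u (e t) (e 1)) t := by
      refine ((hu.differentiable one_ne_zero) (e t)).hasFDerivAt.comp_hasDerivAt t ?_
      have h2 : HasDerivAt (fun t => e t) ((e.toContinuousLinearEquiv : ℝ →L[ℝ] _) 1) t :=
        (e.toContinuousLinearEquiv : ℝ →L[ℝ] EuclideanSpace ℝ (Fin 1)).hasDerivAt
      exact h2
    rw [h1.deriv]
    refine enorm_le_iff_norm_le.2 ?_
    simpa using (fderiv ℝ u (e t)).le_opNorm (e 1)
  have hbound : ∀ x, ‖u x‖ₑ ≤ eLpNorm (fderiv ℝ u) 1 volume := by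
    intro x
    obtain ⟨t, rfl⟩ := e.surjective x
    calc ‖u (e t)‖ₑ ≤ ∫⁻ s in Set.Iic t, ‖deriv (u ∘ e) s‖ₑ :=
          HasCompactSupport.enorm_le_lintegral_Ici_deriv hg hgc t
      _ ≤ ∫⁻ s, ‖deriv (u ∘ e) s‖ₑ := setLIntegral_le_lintegral _ _
      _ ≤ ∫⁻ s, ‖fderiv ℝ u (e s)‖ₑ := lintegral_mono hderiv
      _ = eLpNorm (fderiv ℝ u) 1 volume := by
          rw [eLpNorm_one_eq_lintegral_enorm]
          exact he.lintegral_comp (hu.continuous_fderiv one_ne_zero).enorm.measurable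
  have hv : volume (Metric.ball (0 : EuclideanSpace ℝ (Fin 1)) 1) ^ (1 / 2 : ℝ) ≠ ⊤ :=
    ENNReal.rpow_ne_top_of_nonneg (by norm_num) measure_ball_lt_top.ne
  rw [ENNReal.coe_toNNReal hv,
    ← eLpNorm_restrict_eq_of_support_subset ((subset_tsupport u).trans hs)]
  rw [eLpNorm_eq_lintegral_rpow_enorm_toReal (by norm_num) (by norm_num)]
  calc (∫⁻ x in Metric.ball 0 1, ‖u x‖ₑ ^ (2 : ℝ≥0∞).toReal) ^ (1 / (2 : ℝ≥0∞).toReal)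
      ≤ (∫⁻ _ in Metric.ball (0 : EuclideanSpace ℝ (Fin 1)) 1,
          eLpNorm (fderiv ℝ u) 1 volume ^ (2 : ℝ)) ^ (1 / 2 : ℝ) := by
        simp only [ENNReal.toReal_ofNat]
        gcongr with x
        exact hbound x
    _ = _ := by
        rw [setLIntegral_const, ENNReal.mul_rpow_of_nonneg _ _ (by norm_num), ← ENNReal.rpow_mul,
          mul_comm]
        norm_num

/-- The Sobolev inequality `W₀^{1,1} ⊆ L^q` on the unit ball, with some `q > 1`. -/
theorem exists_sobolev {n : ℕ} (hn : n ≠ 0) :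
    ∃ q : ℝ≥0, 1 < q ∧ ∃ C : ℝ≥0, ∀ u : EuclideanSpace ℝ (Fin n) → ℝ, ContDiff ℝ 1 u →
      HasCompactSupport u → tsupport u ⊆ Metric.ball 0 1 →
        eLpNorm u q volume ≤ C * eLpNorm (fderiv ℝ u) 1 volume := by
  rcases (Nat.one_le_iff_ne_zero.2 hn).eq_or_lt with rfl | hn
  · exact ⟨2, by norm_num, _, fun u hu hc hs => eLpNorm_two_le_of_dim_one hu hc hs⟩
  · have h1 : (1 : ℝ≥0) < n := by exact_mod_cast hn
    have h2 := NNReal.HolderConjugate.conjExponent h1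
    refine ⟨NNReal.conjExponent n, h2.symm.lt, _, fun u hu hc _ =>
      eLpNorm_le_eLpNorm_fderiv_one volume hu hc (p := NNReal.conjExponent n) ?_⟩
    simpa using h2

theorem fderiv_sq {E : Type*} [NormedAddCommGroup E] [NormedSpace ℝ E] {u : E → ℝ} {x : E}
    (hu : DifferentiableAt ℝ u x) :
    fderiv ℝ (fun y => u y ^ 2) x = (2 * u x) • fderiv ℝ u x := by
  rw [fderiv_fun_pow 2 hu]
  simp

/-- The Sobolev inequality applied to the square of a test function. -/
theorem eLpNorm_sq_le {n : ℕ} {q C : ℝ≥0}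
    (hC : ∀ u : EuclideanSpace ℝ (Fin n) → ℝ, ContDiff ℝ 1 u →
      HasCompactSupport u → tsupport u ⊆ Metric.ball 0 1 →
        eLpNorm u q volume ≤ C * eLpNorm (fderiv ℝ u) 1 volume)
    {r : ℝ} (hr : r ≤ 1) {φ : EuclideanSpace ℝ (Fin n) → ℝ}
    (hφ : IsTestFunction (Metric.ball 0 r) φ) :
    eLpNorm (fun x => φ x ^ 2) q (volume.restrict (Metric.ball 0 r)) ≤
      2 * C * (eLpNorm φ 2 (volume.restrict (Metric.ball 0 r)) *
        eLpNorm (gradient φ) 2 (volume.restrict (Metric.ball 0 r))) := by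
  have h1le : (1 : WithTop ℕ∞) ≤ ((⊤ : ℕ∞) : WithTop ℕ∞) := by exact_mod_cast le_top
  have hφ1 : ContDiff ℝ 1 φ := hφ.contDiff.of_le h1le
  have hts : tsupport (fun x => φ x ^ 2) ⊆ tsupport φ := by
    simp_rw [pow_two]
    exact tsupport_mul_subset_left
  have hc2 : HasCompactSupport (fun x => φ x ^ 2) :=
    hφ.hasCompactSupport.comp_left (g := fun t : ℝ => t ^ 2) (by norm_num)
  have hsob := hC (fun x => φ x ^ 2) (hφ1.pow 2) hc2
    ((hts.trans hφ.tsupport_subset).trans (Metric.ball_subset_ball hr))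
  have hzero : ∀ x ∉ Metric.ball (0 : EuclideanSpace ℝ (Fin n)) r,
      fderiv ℝ (fun x => φ x ^ 2) x = 0 := fun x hx =>
    fderiv_of_notMem_tsupport ℝ fun h => hx (hφ.tsupport_subset (hts h))
  have hres : eLpNorm (fderiv ℝ fun x => φ x ^ 2) 1 volume =
      ∫⁻ x in Metric.ball 0 r, ‖fderiv ℝ (fun x => φ x ^ 2) x‖ₑ := by
    rw [eLpNorm_one_eq_lintegral_enorm, ← lintegral_indicator Metric.isOpen_ball.measurableSet]
    refine lintegral_congr fun x => ?_
    by_cases hx : x ∈ Metric.ball (0 : EuclideanSpace ℝ (Fin n)) r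
    · rw [Set.indicator_of_mem hx]
    · rw [Set.indicator_of_notMem hx, hzero x hx, ← ofReal_norm, norm_zero,
        ENNReal.ofReal_zero]
  refine (eLpNorm_restrict_le _ _ _ _).trans (hsob.trans ?_)
  rw [hres, mul_comm 2 (C : ℝ≥0∞), mul_assoc]
  refine mul_le_mul_right ?_ _
  have hgc : Continuous (gradient φ) := continuous_gradient hφ1
  -- Cauchy–Schwarz for `∇(φ²) = 2φ∇φ`. Using the `W^{1,1}` embedding on the square avoids an
  -- exceptional case in dimension two.
  have h := eLpNorm_le_eLpNorm_mul_eLpNorm'_of_norm (p := 2) (q := 2) (r := 1)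
    (μ := volume.restrict (Metric.ball (0 : EuclideanSpace ℝ (Fin n)) r))
    hφ1.continuous.aestronglyMeasurable hgc.aestronglyMeasurable
    (fun (a : ℝ) (v : EuclideanSpace ℝ (Fin n)) => (2 * a) • v) 2
    (ae_of_all _ fun x => by rw [norm_smul, norm_mul]; simp)
  rw [eLpNorm_one_eq_lintegral_enorm] at h
  refine le_trans (le_of_eq ?_) (h.trans (le_of_eq ?_))
  · refine lintegral_congr fun x => ?_
    rw [fderiv_sq (hφ1.differentiable one_ne_zero x), enorm_smul, enorm_smul]
    congr 1
    rw [← ofReal_norm, ← ofReal_norm, norm_gradient_eq]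
  · simp [mul_assoc]

/-- The Sobolev inequality for products of a cutoff and a strong limit of smooth functions. -/
theorem eLpNorm_sq_mul_le {n : ℕ} {q C : ℝ≥0}
    (hC : ∀ u : EuclideanSpace ℝ (Fin n) → ℝ, ContDiff ℝ 1 u →
      HasCompactSupport u → tsupport u ⊆ Metric.ball 0 1 →
        eLpNorm u q volume ≤ C * eLpNorm (fderiv ℝ u) 1 volume)
    {r : ℝ} (hr : r ≤ 1) {η : EuclideanSpace ℝ (Fin n) → ℝ}
    (hη : IsTestFunction (Metric.ball 0 r) η)
    {v : ℕ → EuclideanSpace ℝ (Fin n) → ℝ} (hv : ∀ j, ContDiff ℝ ∞ (v j))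
    {w : EuclideanSpace ℝ (Fin n) → ℝ} {F : EuclideanSpace ℝ (Fin n) → EuclideanSpace ℝ (Fin n)}
    (hw : MemLp w 2 (volume.restrict (Metric.ball 0 r)))
    (hF : MemLp F 2 (volume.restrict (Metric.ball 0 r)))
    (h0 : Tendsto (fun j => eLpNorm (fun x => v j x - w x) 2
      (volume.restrict (Metric.ball 0 r))) atTop (𝓝 0))
    (h1 : Tendsto (fun j => eLpNorm (fun x => gradient (v j) x - F x) 2
      (volume.restrict (Metric.ball 0 r))) atTop (𝓝 0)) :
    eLpNorm (fun x => (η x * w x) ^ 2) q (volume.restrict (Metric.ball 0 r)) ≤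
      2 * C * (eLpNorm (fun x => η x * w x) 2 (volume.restrict (Metric.ball 0 r)) *
        eLpNorm (fun x => η x • F x + w x • gradient η x) 2
          (volume.restrict (Metric.ball 0 r))) := by
  set μ : Measure (EuclideanSpace ℝ (Fin n)) := volume.restrict (Metric.ball 0 r) with hμ
  have h1le : (1 : WithTop ℕ∞) ≤ ((⊤ : ℕ∞) : WithTop ℕ∞) := by exact_mod_cast le_top
  have htest : ∀ j, IsTestFunction (Metric.ball 0 r) (fun y => η y * v j y) := fun j =>
    ⟨hη.contDiff.mul (hv j), hη.hasCompactSupport.mul_right,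
      tsupport_mul_subset_left.trans hη.tsupport_subset⟩
  have hcont : ∀ j, Continuous fun y => η y * v j y := fun j => (htest j).contDiff.continuous
  have hηw : MemLp (fun x => η x * w x) 2 μ :=
    memLp_smul_of_hasCompactSupport hη.contDiff.continuous hη.hasCompactSupport hw
  have hψ : MemLp (fun x => η x • F x + w x • gradient η x) 2 μ :=
    (memLp_smul_of_hasCompactSupport hη.contDiff.continuous hη.hasCompactSupport hF).add
      (memLp_smul_gradient hη.contDiff hη.hasCompactSupport hw)
  have hlim := tendsto_eLpNorm_gradient_mul hη.contDiff hη.hasCompactSupport hv hw.1 hF.1 h0 h1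
  have hlim0 : Tendsto (fun j => eLpNorm ((fun x => η x * v j x) - fun x => η x * w x) 2 μ)
      atTop (𝓝 0) := by
    obtain ⟨M, hM⟩ := hη.hasCompactSupport.exists_bound_of_continuous hη.contDiff.continuous
    have a1 := ENNReal.Tendsto.const_mul h0 (Or.inr (ENNReal.ofReal_ne_top (r := M)))
    rw [mul_zero] at a1
    refine tendsto_of_tendsto_of_tendsto_of_le_of_le tendsto_const_nhds a1
      (fun _ => zero_le) fun j => ?_
    refine eLpNorm_le_mul_eLpNorm_of_ae_le_mul (ae_of_all _ fun x => ?_) 2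
    rw [Pi.sub_apply, ← mul_sub, norm_mul]
    exact mul_le_mul_of_nonneg_right (hM x) (norm_nonneg _)
  obtain ⟨ns, hns, hae⟩ := (tendstoInMeasure_of_tendsto_eLpNorm (by norm_num)
    (fun j => (hcont j).aestronglyMeasurable) hηw.1 hlim0).exists_seq_tendsto_ae
  -- Convergence is known only in `L²`, so the `L^q` norm is passed to the limit by Fatou along an
  -- almost everywhere convergent subsequence.
  have hfatou : eLpNorm (fun x => (η x * w x) ^ 2) q μ ≤
      atTop.liminf fun k => eLpNorm (fun x => (η x * v (ns k) x) ^ 2) q μ := by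
    refine Lp.eLpNorm_lim_le_liminf_eLpNorm
      (fun k => ((hcont (ns k)).pow 2).aestronglyMeasurable) _ ?_
    filter_upwards [hae] with x hx using hx.pow 2
  set N : ℕ → ℝ≥0∞ := fun j => 2 * C *
    ((eLpNorm ((fun x => η x * v j x) - fun x => η x * w x) 2 μ + eLpNorm (fun x => η x * w x) 2 μ) *
    (eLpNorm (fun x => gradient (fun y => η y * v j y) x - (η x • F x + w x • gradient η x)) 2 μ +
      eLpNorm (fun x => η x • F x + w x • gradient η x) 2 μ)) with hN
  have hbd : ∀ j, eLpNorm (fun x => (η x * v j x) ^ 2) q μ ≤ N j := by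
    intro j
    refine (eLpNorm_sq_le hC hr (htest j)).trans ?_
    have t1 := eLpNorm_add_le (μ := μ) (((hcont j).aestronglyMeasurable).sub hηw.1) hηw.1
      (p := 2) (by norm_num)
    have hgj := (continuous_gradient ((htest j).contDiff.of_le h1le)).aestronglyMeasurable (μ := μ)
    have t2 := eLpNorm_add_le (μ := μ) (hgj.sub hψ.1) hψ.1 (p := 2) (by norm_num)
    rw [sub_add_cancel] at t1 t2
    exact mul_le_mul_right (mul_le_mul' t1 t2) _
  have hNlim : Tendsto (fun k => N (ns k)) atTop (𝓝 (2 * C *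
      (eLpNorm (fun x => η x * w x) 2 μ *
        eLpNorm (fun x => η x • F x + w x • gradient η x) 2 μ))) := by
    have c1 := (hlim0.comp hns.tendsto_atTop).add_const (eLpNorm (fun x => η x * w x) 2 μ)
    have c2 := (hlim.comp hns.tendsto_atTop).add_const
      (eLpNorm (fun x => η x • F x + w x • gradient η x) 2 μ)
    rw [zero_add] at c1 c2
    exact ENNReal.Tendsto.const_mul (ENNReal.Tendsto.mul c1 (Or.inr hψ.2.ne) c2
      (Or.inr hηw.2.ne)) (Or.inr (ENNReal.mul_ne_top (by norm_num) ENNReal.coe_ne_top))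
  refine hfatou.trans ?_
  rw [← hNlim.liminf_eq]
  exact liminf_le_liminf (Eventually.of_forall fun k => hbd (ns k))

/-! ### Cutoff functions. -/

section Cutoff

/-- Such a point is a global minimum, which also covers the endpoint `t = 0`. -/
theorem deriv_smoothTransition_of_nonpos {t : ℝ} (ht : t ≤ 0) :
    deriv Real.smoothTransition t = 0 := by
  refine IsLocalMin.deriv_eq_zero (Eventually.of_forall fun s => ?_)
  rw [Real.smoothTransition.zero_of_nonpos ht]
  exact Real.smoothTransition.nonneg s

theorem deriv_smoothTransition_of_one_le {t : ℝ} (ht : 1 ≤ t) :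
    deriv Real.smoothTransition t = 0 := by
  refine IsLocalMax.deriv_eq_zero (Eventually.of_forall fun s => ?_)
  rw [Real.smoothTransition.one_of_one_le ht]
  exact Real.smoothTransition.le_one s

theorem exists_bound_deriv_smoothTransition :
    ∃ K : ℝ, ∀ t, ‖deriv Real.smoothTransition t‖ ≤ K := by
  have hc : HasCompactSupport (deriv Real.smoothTransition) := by
    refine HasCompactSupport.intro (isCompact_Icc (a := (0 : ℝ)) (b := 1)) fun t ht => ?_
    rcases lt_or_ge t 0 with h | h
    · exact deriv_smoothTransition_of_nonpos h.le
    · refine deriv_smoothTransition_of_one_le ?_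
      by_contra h1
      exact ht ⟨h, (not_le.1 h1).le⟩
  exact hc.exists_bound_of_continuous
    ((Real.smoothTransition.contDiff (n := 1)).continuous_deriv le_rfl)

/-- Smooth cutoffs between concentric balls, with the natural gradient bound. -/
theorem exists_cutoff (n : ℕ) : ∃ K : ℝ, 0 ≤ K ∧ ∀ s s' : ℝ, s < s' → s' ≤ 1 / 2 →
    ∃ η : EuclideanSpace ℝ (Fin n) → ℝ, IsTestFunction (Metric.ball 0 (3 / 4)) η ∧
      (∀ x, 0 ≤ η x) ∧ (∀ x, η x ≤ 1) ∧ (∀ x, ‖x‖ ^ 2 < s → η x = 1) ∧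
      (∀ x, s' ≤ ‖x‖ ^ 2 → η x = 0) ∧ (∀ x, s' ≤ ‖x‖ ^ 2 → gradient η x = 0) ∧
      ∀ x, ‖gradient η x‖ ≤ K * (1 / (s' - s)) := by
  obtain ⟨K, hK⟩ := exists_bound_deriv_smoothTransition
  have hK0 : 0 ≤ K := (norm_nonneg _).trans (hK 0)
  refine ⟨2 * K, by positivity, fun s s' hs hs' => ?_⟩
  have hd : 0 < s' - s := sub_pos.2 hs
  -- Using `‖x‖²` rather than `‖x‖` keeps the cutoff smooth at the origin. Its gradient brings a
  -- factor `2‖x‖`, at most `2` where `‖x‖² < s' ≤ 1/2`.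
  set g : EuclideanSpace ℝ (Fin n) → ℝ := fun x => (s' - ‖x‖ ^ 2) / (s' - s) with hg
  have hgs : ContDiff ℝ ∞ g := (contDiff_const.sub (contDiff_norm_sq ℝ)).div_const _
  have hηs : ContDiff ℝ ∞ (fun x => Real.smoothTransition (g x)) :=
    Real.smoothTransition.contDiff.comp hgs
  have hgn : ∀ x, s' ≤ ‖x‖ ^ 2 → g x ≤ 0 := fun x hx =>
    div_nonpos_of_nonpos_of_nonneg (by linarith) hd.le
  have hsupp : tsupport (fun x => Real.smoothTransition (g x)) ⊆ {x | ‖x‖ ^ 2 ≤ s'} := by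
    refine closure_minimal (fun x hx => ?_)
      (isClosed_le (continuous_norm.pow 2) continuous_const)
    by_contra h
    exact hx (Real.smoothTransition.zero_of_nonpos (hgn x (le_of_not_ge h)))
  have hsub : {x : EuclideanSpace ℝ (Fin n) | ‖x‖ ^ 2 ≤ s'} ⊆ Metric.ball 0 (3 / 4) := by
    intro x hx
    have hx' : ‖x‖ ^ 2 ≤ s' := hx
    rw [mem_ball_zero_iff]
    by_contra h
    nlinarith [not_lt.1 h]
  have hgradg : ∀ x, fderiv ℝ g x = (-(2 / (s' - s))) • innerSL ℝ x := by
    intro x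
    have h1 : HasFDerivAt (fun x : EuclideanSpace ℝ (Fin n) => ‖x‖ ^ 2) (2 • innerSL ℝ x) x :=
      (hasStrictFDerivAt_norm_sq x).hasFDerivAt
    have h2 : HasFDerivAt g ((s' - s)⁻¹ • -(2 • innerSL ℝ x : EuclideanSpace ℝ (Fin n) →L[ℝ] ℝ)) x := by
      have := (h1.const_sub s').const_mul (s' - s)⁻¹
      refine this.congr_of_eventuallyEq (Eventually.of_forall fun y => ?_)
      simp only [hg]
      rw [div_eq_inv_mul]
    rw [h2.fderiv]
    ext y
    simp
    ring
  have hgrad : ∀ x, gradient (fun x => Real.smoothTransition (g x)) x =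
      deriv Real.smoothTransition (g x) • gradient g x := fun x =>
    gradient_comp_real
      ((Real.smoothTransition.contDiff (n := 1)).differentiable one_ne_zero _)
      (hgs.differentiable (by simp) x)
  have hgrad0 : ∀ x, s' ≤ ‖x‖ ^ 2 → gradient (fun x => Real.smoothTransition (g x)) x = 0 :=
    fun x hx => by rw [hgrad, deriv_smoothTransition_of_nonpos (hgn x hx), zero_smul]
  refine ⟨fun x => Real.smoothTransition (g x), ⟨hηs, ?_, hsupp.trans hsub⟩,
    fun x => Real.smoothTransition.nonneg _, fun x => Real.smoothTransition.le_one _,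
    fun x hx => ?_, fun x hx => Real.smoothTransition.zero_of_nonpos (hgn x hx), hgrad0,
    fun x => ?_⟩
  · exact HasCompactSupport.of_support_subset_isCompact (isCompact_closedBall 0 (3 / 4))
      ((subset_tsupport _).trans ((hsupp.trans hsub).trans Metric.ball_subset_closedBall))
  · refine Real.smoothTransition.one_of_one_le ?_
    rw [hg, le_div_iff₀ hd]
    linarith
  · rcases le_or_gt s' (‖x‖ ^ 2) with h | h
    · rw [hgrad0 x h, norm_zero]
      positivity
    · have hx1 : ‖x‖ ≤ 1 := by
        by_contra h1
        nlinarith [not_le.1 h1]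
      have h2 : ‖gradient g x‖ = 2 / (s' - s) * ‖x‖ := by
        rw [norm_gradient_eq, hgradg, norm_smul, innerSL_apply_norm, norm_neg,
          Real.norm_of_nonneg (by positivity)]
      rw [hgrad, norm_smul, h2]
      calc _ ≤ K * (2 / (s' - s) * 1) := by gcongr; exact hK _
        _ = _ := by ring

end Cutoff

/-! ### The superlinear recursion. -/

section Iteration

/-- Superlinear recursions with geometric growth converge to zero from small initial data. -/
theorem exists_tendsto_zero_of_superlinear (C : ℝ≥0) {α : ℝ} (hα : 0 < α) :
    ∃ δ : ℝ, 0 < δ ∧ ∀ P : ℕ → ℝ≥0∞,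
      (∀ k, P (k + 1) ≤ C * 8 ^ k * P k ^ (1 + α)) → P 0 ≤ ENNReal.ofReal δ →
        Tendsto P atTop (𝓝 0) := by
  -- The claim is `P k ≤ δ γ^k`. The choice `γ^α = 1/8` cancels the growth `8^k`, and `δ^α = γ / (C
  -- + 1)` supplies the next factor `γ`; `C + 1` allows `C = 0`.
  set γ : ℝ := (1 / 8 : ℝ) ^ (1 / α) with hγ
  have hγ0 : 0 < γ := by positivity
  have hγ1 : γ < 1 := Real.rpow_lt_one (by norm_num) (by norm_num) (by positivity)
  have hγα : γ ^ α = 1 / 8 := by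
    rw [hγ, ← Real.rpow_mul (by norm_num), one_div_mul_cancel hα.ne', Real.rpow_one]
  set δ : ℝ := (γ / (C + 1)) ^ (1 / α) with hδ
  have hδ0 : 0 < δ := by positivity
  have hδα : δ ^ α = γ / (C + 1) := by
    rw [hδ, ← Real.rpow_mul (by positivity), one_div_mul_cancel hα.ne', Real.rpow_one]
  refine ⟨δ, hδ0, fun P hP h0 => ?_⟩
  have hbound : ∀ k, P k ≤ ENNReal.ofReal (δ * γ ^ k) := by
    intro k
    induction k with
    | zero => simpa using h0
    | succ k ih =>
      refine (hP k).trans ?_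
      have h1 : P k ^ (1 + α) ≤ ENNReal.ofReal ((δ * γ ^ k) ^ (1 + α)) := by
        rw [← ENNReal.ofReal_rpow_of_nonneg (by positivity) (by positivity)]
        exact ENNReal.rpow_le_rpow ih (by positivity)
      refine (mul_le_mul_right h1 _).trans ?_
      have h2 : ((C : ℝ≥0∞) * 8 ^ k) = ENNReal.ofReal (C * 8 ^ k) := by
        rw [ENNReal.ofReal_mul (by positivity), ENNReal.ofReal_pow (by norm_num)]
        simp
      rw [h2, ← ENNReal.ofReal_mul (by positivity)]
      refine ENNReal.ofReal_le_ofReal ?_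
      have h3 : (δ * γ ^ k) ^ (1 + α) = δ * γ ^ k * (γ / (C + 1) * (1 / 8) ^ k) := by
        rw [Real.rpow_add (by positivity), Real.rpow_one, Real.mul_rpow hδ0.le (by positivity),
          hδα, ← Real.rpow_natCast, ← Real.rpow_mul hγ0.le, mul_comm (k : ℝ) α,
          Real.rpow_mul hγ0.le, hγα]
        simp only [Real.rpow_natCast]
      rw [h3]
      have h4 : (C : ℝ) * 8 ^ k * (δ * γ ^ k * (γ / (C + 1) * (1 / 8) ^ k)) =
          C / (C + 1) * (δ * γ ^ (k + 1)) := by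
        have h8 : (8 : ℝ) ^ k * (1 / 8) ^ k = 1 := by rw [← mul_pow]; norm_num
        calc _ = C / (C + 1) * (δ * γ ^ (k + 1)) * ((8 : ℝ) ^ k * (1 / 8) ^ k) := by ring
          _ = _ := by rw [h8, mul_one]
      rw [h4]
      refine mul_le_of_le_one_left (by positivity) ?_
      rw [div_le_one (by positivity)]
      linarith
  have hlim : Tendsto (fun k : ℕ => ENNReal.ofReal (δ * γ ^ k)) atTop (𝓝 0) := by
    have := ENNReal.tendsto_ofReal ((tendsto_pow_atTop_nhds_zero_of_lt_one hγ0.le hγ1).const_mul δ)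
    simpa using this
  exact tendsto_of_tendsto_of_tendsto_of_le_of_le tendsto_const_nhds hlim
    (fun _ => zero_le) hbound

end Iteration

/-! ### One step of the iteration. -/

theorem eLpNorm_two_sq {α F : Type*} [MeasurableSpace α] [NormedAddCommGroup F] (g : α → F)
    (μ : Measure α) : eLpNorm g 2 μ ^ 2 = ∫⁻ x, ‖g x‖ₑ ^ 2 ∂μ := by
  have := eLpNorm_two_rpow g μ
  simpa using this

/-- Hölder's inequality on the support. -/
theorem eLpNorm_two_sq_le_of_support_subset {α : Type*} [MeasurableSpace α] {μ : Measure α}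
    {g : α → ℝ} (hg : AEStronglyMeasurable g μ) {S : Set α} (hS : Function.support g ⊆ S)
    {q : ℝ≥0} (hq : 1 < q) :
    eLpNorm g 2 μ ^ 2 ≤ eLpNorm (fun x => g x ^ 2) q μ * μ S ^ (1 - (q : ℝ)⁻¹) := by
  have hS2 : Function.support (fun x => g x ^ 2) ⊆ S := fun x hx => hS fun h => hx (by simp [h])
  have h1 : eLpNorm g 2 μ ^ 2 = eLpNorm (fun x => g x ^ 2) 1 μ := by
    rw [eLpNorm_two_sq, eLpNorm_one_eq_lintegral_enorm]
    simp_rw [enorm_pow]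
  rw [h1, ← eLpNorm_restrict_eq_of_support_subset hS2,
    ← eLpNorm_restrict_eq_of_support_subset (p := q) hS2]
  have h2 := eLpNorm_le_eLpNorm_mul_rpow_measure_univ (p := 1) (q := q) (μ := μ.restrict S)
    (f := fun x => g x ^ 2) (by exact_mod_cast hq.le) (hg.pow 2).restrict
  rw [Measure.restrict_apply_univ] at h2
  simpa using h2

/-- One step of the De Giorgi iteration: superlinear decay of the energy of the truncations
between two concentric balls. -/
theorem exists_energy_step {n : ℕ} (hn : n ≠ 0) {Λ : ℝ} (hΛ : 0 < Λ) :
    ∃ α : ℝ, 0 < α ∧ α ≤ 1 ∧ ∃ C : ℝ≥0,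
      ∀ (A : EuclideanSpace ℝ (Fin n) → Matrix (Fin n) (Fin n) ℝ)
        (f : EuclideanSpace ℝ (Fin n) → ℝ),
        IsUniformlyElliptic (Metric.ball 0 1) Λ A → MemH1 (Metric.ball 0 1) f →
        IsWeakSubsolution (Metric.ball 0 1) A f →
        ∀ s s' l l' : ℝ, s < s' → s' ≤ 1 / 2 → l < l' →
          eLpNorm (fun x => max (f x - l') 0) 2 (volume.restrict {x | ‖x‖ ^ 2 < s}) ^ 2 ≤
            C * ENNReal.ofReal (1 / (s' - s)) *
              (ENNReal.ofReal ((1 / (l' - l)) ^ 2)) ^ α *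
              (eLpNorm (fun x => max (f x - l) 0) 2
                (volume.restrict {x | ‖x‖ ^ 2 < s'}) ^ 2) ^ (1 + α) := by
  obtain ⟨q, hq, C₀, hC₀⟩ := exists_sobolev hn
  obtain ⟨K, hK0, hK⟩ := exists_cutoff n
  have hq' : (1 : ℝ) < q := by exact_mod_cast hq
  -- The exponent is the one that Hölder's inequality puts on the measure of the support.
  refine ⟨1 - (q : ℝ)⁻¹, sub_pos.2 (inv_lt_one_of_one_lt₀ hq'), by
    have : 0 ≤ (q : ℝ)⁻¹ := by positivity
    linarith, 2 * C₀ * (4 * Λ + 1).toNNReal * K.toNNReal, ?_⟩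
  intro A f hA hfH hsub s s' l l' hs hs' hl
  obtain ⟨hf, -⟩ := hfH
  obtain ⟨G, hw, hG, htest⟩ := hsub
  obtain ⟨η, hη, hη0, hη1, hηone, hηzero, hηgz, hηg⟩ := hK s s' hs hs'
  have hr : (3 / 4 : ℝ) < 1 := by norm_num
  set α : ℝ := 1 - (q : ℝ)⁻¹ with hα
  have hα0 : 0 ≤ α := (sub_pos.2 (inv_lt_one_of_one_lt₀ hq')).le
  set μ : Measure (EuclideanSpace ℝ (Fin n)) := volume.restrict (Metric.ball 0 (3 / 4)) with hμ
  have hfin : IsFiniteMeasure μ := ⟨by simp [hμ, measure_ball_lt_top]⟩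
  have hmono : μ ≤ volume.restrict (Metric.ball 0 1) :=
    Measure.restrict_mono (Metric.ball_subset_ball hr.le) le_rfl
  have hfμ : MemLp f 2 μ := hf.mono_measure hmono
  have hGμ : MemLp G 2 μ := hG.mono_measure hmono
  obtain ⟨u, hu, huf, huG⟩ := exists_smooth_tendsto hr hw hf hG
  obtain ⟨v, hv, -, hvf, hvG⟩ := exists_smooth_tendsto_posPart hu hfμ.1 hGμ huf huG l'
  have hw2 := memLp_posPart_sub hfμ l'
  have hF2 := memLp_truncated hfμ.1 hGμ l'
  have hmeas : ∀ t : ℝ, MeasurableSet {x : EuclideanSpace ℝ (Fin n) | ‖x‖ ^ 2 < t} := fun t =>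
    (isOpen_lt (continuous_norm.pow 2) continuous_const).measurableSet
  have hball : ∀ t : ℝ, t ≤ 1 / 2 →
      {x : EuclideanSpace ℝ (Fin n) | ‖x‖ ^ 2 < t} ⊆ Metric.ball 0 (3 / 4) := by
    intro t ht x hx
    have hx' : ‖x‖ ^ 2 < t := hx
    rw [mem_ball_zero_iff]
    by_contra h
    nlinarith [not_lt.1 h]
  set N := eLpNorm (fun x => max (f x - l) 0) 2 (volume.restrict {x | ‖x‖ ^ 2 < s'}) with hN
  set g : EuclideanSpace ℝ (Fin n) → ℝ := fun x => η x * max (f x - l') 0 with hg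
  have hg2 : MemLp g 2 μ :=
    memLp_smul_of_hasCompactSupport hη.contDiff.continuous hη.hasCompactSupport hw2
  have hpm : ∀ x, max (f x - l') 0 ≤ max (f x - l) 0 := fun x =>
    max_le_max (by linarith) le_rfl
  -- Functions vanishing off `{‖x‖² < s'}` and dominated by `(f - l)₊`
  have hdom : ∀ {F' : Type} [NormedAddCommGroup F'] (h : EuclideanSpace ℝ (Fin n) → F') (c : ℝ),
      (∀ x, s' ≤ ‖x‖ ^ 2 → h x = 0) → (∀ x, ‖h x‖ ≤ c * max (f x - l) 0) →
      eLpNorm h 2 μ ≤ ENNReal.ofReal c * N := by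
    intro F' _ h c h0 hle
    have hsupp : Function.support h ⊆ {x | ‖x‖ ^ 2 < s'} := fun x hx => by
      by_contra hx'
      exact hx (h0 x (not_lt.1 hx'))
    calc eLpNorm h 2 μ ≤ eLpNorm h 2 volume := eLpNorm_restrict_le _ _ _ _
      _ = eLpNorm h 2 (volume.restrict {x | ‖x‖ ^ 2 < s'}) :=
        (eLpNorm_restrict_eq_of_support_subset hsupp).symm
      _ ≤ _ := by
        refine eLpNorm_le_mul_eLpNorm_of_ae_le_mul (ae_of_all _ fun x => ?_) 2
        rw [Real.norm_of_nonneg (le_max_right (f x - l) 0)]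
        exact hle x
  have hgN : eLpNorm g 2 μ ≤ N := by
    have := hdom g 1 (fun x hx => by simp [hg, hηzero x hx]) fun x => by
      rw [hg, norm_mul, Real.norm_of_nonneg (hη0 x), Real.norm_of_nonneg (le_max_right _ _)]
      exact mul_le_mul (hη1 x) (hpm x) (le_max_right _ _) zero_le_one
    simpa using this
  have hbN : eLpNorm (fun x => max (f x - l') 0 • gradient η x) 2 μ ≤
      ENNReal.ofReal (K * (1 / (s' - s))) * N := by
    refine hdom _ _ (fun x hx => by simp [hηgz x hx]) fun x => ?_
    rw [norm_smul, Real.norm_of_nonneg (le_max_right _ _), mul_comm]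
    exact mul_le_mul (hηg x) (hpm x) (le_max_right _ _)
      (mul_nonneg hK0 (one_div_nonneg.2 (sub_pos.2 hs).le))
  have hcac := caccioppoli hr hΛ hA hf hG hw htest hη l'
  have hsob := eLpNorm_sq_mul_le hC₀ hr.le hη hv hw2 hF2 hvf hvG
  -- The factor `4 * Λ` is Caccioppoli's for `η ∇w`; the extra `1` accounts for `w ∇η`.
  have hgradN : eLpNorm (fun x => η x • (if l' < f x then (1 : ℝ) else 0) • G x +
      max (f x - l') 0 • gradient η x) 2 μ ≤
      ENNReal.ofReal (4 * Λ + 1) * (ENNReal.ofReal (K * (1 / (s' - s))) * N) := by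
    refine (eLpNorm_add_le (memLp_smul_of_hasCompactSupport hη.contDiff.continuous
      hη.hasCompactSupport hF2).1 (memLp_smul_gradient hη.contDiff hη.hasCompactSupport hw2).1
      (by norm_num)).trans ?_
    rw [ENNReal.ofReal_add (by positivity) zero_le_one, ENNReal.ofReal_one, add_mul, one_mul]
    exact add_le_add (hcac.trans (mul_le_mul_right hbN _)) hbN
  -- Chebyshev: `(f - l)₊ ≥ l' - l` wherever `f > l'`. This makes the estimate superlinear.
  have hTmeas : μ ({x | l' < f x} ∩ {x | ‖x‖ ^ 2 < s'}) ≤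
      ENNReal.ofReal ((1 / (l' - l)) ^ 2) * N ^ 2 := by
    have hd : 0 < l' - l := sub_pos.2 hl
    have hfs : AEStronglyMeasurable (fun x => max (f x - l) 0)
        (volume.restrict {x | ‖x‖ ^ 2 < s'}) :=
      (memLp_posPart_sub hfμ l).1.mono_measure (Measure.restrict_mono (hball s' hs') le_rfl)
    have hcheb := meas_ge_le_mul_pow_eLpNorm_enorm (volume.restrict {x | ‖x‖ ^ 2 < s'})
      (p := 2) (by norm_num) (by norm_num) hfs (ε := ENNReal.ofReal (l' - l))
      (by simpa using hd) (by simp)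
    refine (Measure.restrict_apply_le _ _).trans ?_
    rw [← Measure.restrict_apply' (hmeas s')]
    refine (measure_mono fun x hx => ?_).trans (hcheb.trans (le_of_eq ?_))
    · have hx' : l' < f x := hx
      rw [Set.mem_ofPred_eq, Real.enorm_eq_ofReal (le_max_right _ _)]
      exact ENNReal.ofReal_le_ofReal (le_max_of_le_left (by linarith))
    · rw [ENNReal.toReal_ofNat, ENNReal.rpow_ofNat, ENNReal.rpow_ofNat,
        ← ENNReal.ofReal_inv_of_pos hd, ENNReal.ofReal_pow (by positivity), one_div]
  have hgS : Function.support g ⊆ {x | l' < f x} ∩ {x | ‖x‖ ^ 2 < s'} := by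
    intro x hx
    refine ⟨?_, ?_⟩
    · by_contra h
      have h' : f x ≤ l' := not_lt.1 h
      exact hx (by simp [hg, max_eq_right (sub_nonpos.2 h')])
    · by_contra h
      exact hx (by simp [hg, hηzero x (not_lt.1 h)])
  have hstart : eLpNorm (fun x => max (f x - l') 0) 2 (volume.restrict {x | ‖x‖ ^ 2 < s}) ≤
      eLpNorm g 2 μ := by
    refine le_trans (le_of_eq ?_)
      (eLpNorm_mono_measure g (Measure.restrict_mono (hball s (hs.le.trans hs')) le_rfl))
    refine eLpNorm_congr_ae ?_
    filter_upwards [ae_restrict_mem (hmeas s)] with x hx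
    simp only [hg]
    rw [hηone x hx, one_mul]
  have hsob' : eLpNorm (fun x => g x ^ 2) q μ ≤ 2 * C₀ * (N * (ENNReal.ofReal (4 * Λ + 1) *
      (ENNReal.ofReal (K * (1 / (s' - s))) * N))) :=
    hsob.trans (mul_le_mul_right (mul_le_mul' hgN hgradN) _)
  -- Only one of the two factors in the Sobolev bound is a gradient, so `1 / (s' - s)` enters to the
  -- first power.
  calc _ ≤ eLpNorm g 2 μ ^ 2 := pow_le_pow_left' hstart 2
    _ ≤ eLpNorm (fun x => g x ^ 2) q μ * μ ({x | l' < f x} ∩ {x | ‖x‖ ^ 2 < s'}) ^ α :=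
      eLpNorm_two_sq_le_of_support_subset hg2.1 hgS hq
    _ ≤ 2 * C₀ * (N * (ENNReal.ofReal (4 * Λ + 1) *
        (ENNReal.ofReal (K * (1 / (s' - s))) * N))) *
        (ENNReal.ofReal ((1 / (l' - l)) ^ 2) * N ^ 2) ^ α :=
      mul_le_mul' hsob' (ENNReal.rpow_le_rpow hTmeas hα0)
    _ = _ := by
      rw [ENNReal.mul_rpow_of_nonneg _ _ hα0, ENNReal.ofReal_mul hK0,
        ENNReal.rpow_add_of_nonneg _ _ zero_le_one hα0, ENNReal.rpow_one]
      push_cast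
      simp only [ENNReal.ofReal]
      ring

/-! ### Dimension zero, and the conclusion. -/

/-- The space is a point and every function is constant, so `δ` is half the `L²` norm of the
constant `1`. -/
theorem eLpNorm_top_le_of_dim_zero :
    ∃ δ : ℝ, 0 < δ ∧ ∀ g : EuclideanSpace ℝ (Fin 0) → ℝ,
      eLpNorm g 2 (volume.restrict (Metric.ball 0 1)) ≤ ENNReal.ofReal δ →
        eLpNorm g ∞ (volume.restrict (Metric.ball 0 (1 / 2))) ≤ ENNReal.ofReal (1 / 2) := by
  set V := volume (Metric.ball (0 : EuclideanSpace ℝ (Fin 0)) 1) with hV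
  have hV0 : V ≠ 0 := (Metric.measure_ball_pos _ _ one_pos).ne'
  have hVt : V ≠ ⊤ := measure_ball_lt_top.ne
  have hR0 : V ^ (1 / 2 : ℝ) ≠ 0 := (ENNReal.rpow_pos (pos_iff_ne_zero.2 hV0) hVt).ne'
  have hRt : V ^ (1 / 2 : ℝ) ≠ ⊤ := ENNReal.rpow_ne_top_of_nonneg (by norm_num) hVt
  refine ⟨1 / 2 * (V ^ (1 / 2 : ℝ)).toReal, mul_pos one_half_pos (ENNReal.toReal_pos hR0 hRt),
    fun g hg => ?_⟩
  have hconst : g = fun _ => g 0 := funext fun x => by rw [Subsingleton.elim x 0]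
  rw [ENNReal.ofReal_mul (by norm_num), ENNReal.ofReal_toReal hRt, hconst,
    eLpNorm_const' _ (by norm_num) (by norm_num), Measure.restrict_apply_univ] at hg
  have hg0 : ‖g 0‖ₑ ≤ ENNReal.ofReal (1 / 2) :=
    (ENNReal.mul_le_mul_iff_left hR0 hRt).1 (by simpa using hg)
  rw [eLpNorm_exponent_top, hconst]
  exact eLpNormEssSup_le_of_ae_enorm_bound (ae_of_all _ fun _ => hg0)

theorem exists_linfty_bound {n : ℕ} (hn : n ≠ 0) {Λ : ℝ} (hΛ : 0 < Λ) :
    ∃ δ : ℝ, 0 < δ ∧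
      ∀ (A : EuclideanSpace ℝ (Fin n) → Matrix (Fin n) (Fin n) ℝ)
        (f : EuclideanSpace ℝ (Fin n) → ℝ),
        IsUniformlyElliptic (Metric.ball 0 1) Λ A → MemH1 (Metric.ball 0 1) f →
        IsWeakSubsolution (Metric.ball 0 1) A f →
        eLpNorm (fun x => max (f x) 0) 2 (volume.restrict (Metric.ball 0 1)) ≤
          ENNReal.ofReal δ →
        eLpNorm (fun x => max (f x) 0) ∞ (volume.restrict (Metric.ball 0 (1 / 2))) ≤
          ENNReal.ofReal (1 / 2) := by
  obtain ⟨α, hα, hα1, C, hstep⟩ := exists_energy_step hn hΛ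
  obtain ⟨δ, hδ, hiter⟩ := exists_tendsto_zero_of_superlinear (C * 8 * 16) hα
  -- The square root appears because `P 0` is a squared norm.
  refine ⟨√δ, Real.sqrt_pos.2 hδ, fun A f hA hf hsub hsmall => ?_⟩
  set s : ℕ → ℝ := fun k => 1 / 4 + 1 / 4 * (1 / 2) ^ k with hs
  set l : ℕ → ℝ := fun k => 1 / 2 - 1 / 2 * (1 / 2) ^ k with hl
  have hpos : ∀ k : ℕ, (0 : ℝ) < (1 / 2) ^ k := fun k => by positivity
  have hle1 : ∀ k : ℕ, (1 / 2 : ℝ) ^ k ≤ 1 := fun k => pow_le_one₀ (by norm_num) (by norm_num)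
  have hsd : ∀ k, s k - s (k + 1) = 1 / 8 * (1 / 2) ^ k := fun k => by simp only [hs]; ring
  have hld : ∀ k, l (k + 1) - l k = 1 / 4 * (1 / 2) ^ k := fun k => by simp only [hl]; ring
  have hmeas : ∀ t : ℝ, MeasurableSet {x : EuclideanSpace ℝ (Fin n) | ‖x‖ ^ 2 < t} := fun t =>
    (isOpen_lt (continuous_norm.pow 2) continuous_const).measurableSet
  set P : ℕ → ℝ≥0∞ := fun k =>
    eLpNorm (fun x => max (f x - l k) 0) 2 (volume.restrict {x | ‖x‖ ^ 2 < s k}) ^ 2 with hP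
  have hrec : ∀ k, P (k + 1) ≤ (C * 8 * 16 : ℝ≥0) * 8 ^ k * P k ^ (1 + α) := by
    intro k
    have h1 := hstep A f hA hf hsub (s (k + 1)) (s k) (l k) (l (k + 1))
      (by have := hsd k; have := hpos k; linarith)
      (by have := hle1 k; simp only [hs]; linarith)
      (by have := hld k; have := hpos k; linarith)
    refine h1.trans (mul_le_mul_left ?_ _)
    have h2k : ((1 / 2 : ℝ) ^ k)⁻¹ = 2 ^ k := by rw [one_div, inv_pow, inv_inv]
    have e1 : 1 / (s k - s (k + 1)) = 8 * 2 ^ k := by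
      rw [hsd, one_div, mul_inv, h2k]; norm_num
    have e2 : (1 / (l (k + 1) - l k)) ^ 2 = 16 * 4 ^ k := by
      rw [hld, one_div, mul_inv, h2k, mul_pow, ← pow_mul, mul_comm k 2, pow_mul]; norm_num
    -- As `α ≤ 1` and the base is at least one, the power may be dropped; then `2^k · 4^k = 8^k` is
    -- the growth rate of the recursion.
    have e3 : (ENNReal.ofReal (16 * 4 ^ k)) ^ α ≤ ENNReal.ofReal (16 * 4 ^ k) := by
      conv_rhs => rw [← ENNReal.rpow_one (ENNReal.ofReal (16 * 4 ^ k))]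
      refine ENNReal.rpow_le_rpow_of_exponent_le ?_ hα1
      rw [← ENNReal.ofReal_one]
      refine ENNReal.ofReal_le_ofReal ?_
      have : (1 : ℝ) ≤ 4 ^ k := one_le_pow₀ (by norm_num)
      linarith
    rw [e1, e2]
    refine (mul_le_mul_right e3 _).trans (le_of_eq ?_)
    rw [mul_assoc, ← ENNReal.ofReal_mul (by positivity)]
    have e4 : (8 * 2 ^ k * (16 * 4 ^ k) : ℝ) = 8 * 16 * 8 ^ k := by
      have : (8 : ℝ) ^ k = 2 ^ k * 4 ^ k := by rw [← mul_pow]; norm_num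
      rw [this]; ring
    rw [e4, ENNReal.ofReal_mul (by positivity), ENNReal.ofReal_mul (by positivity),
      ENNReal.ofReal_pow (by positivity)]
    push_cast
    simp only [ENNReal.ofReal_ofNat]
    ring
  have hP0 : P 0 ≤ ENNReal.ofReal δ := by
    have hsub1 : {x : EuclideanSpace ℝ (Fin n) | ‖x‖ ^ 2 < s 0} ⊆ Metric.ball 0 1 := by
      intro x hx
      have hx' : ‖x‖ ^ 2 < s 0 := hx
      simp only [hs, pow_zero] at hx'
      rw [mem_ball_zero_iff]
      by_contra h
      nlinarith [not_lt.1 h]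
    have h1 : eLpNorm (fun x => max (f x - l 0) 0) 2 (volume.restrict {x | ‖x‖ ^ 2 < s 0}) ≤
        ENNReal.ofReal √δ := by
      have : l 0 = 0 := by simp [hl]
      simp only [this, sub_zero]
      exact (eLpNorm_mono_measure _ (Measure.restrict_mono hsub1 le_rfl)).trans hsmall
    refine (pow_le_pow_left' h1 2).trans (le_of_eq ?_)
    rw [← ENNReal.ofReal_pow (Real.sqrt_nonneg _), Real.sq_sqrt hδ.le]
  have hlim := hiter P hrec hP0
  have hhalf : Metric.ball (0 : EuclideanSpace ℝ (Fin n)) (1 / 2) ⊆ Metric.ball 0 1 :=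
    Metric.ball_subset_ball (by norm_num)
  have hfin : IsFiniteMeasure (volume.restrict (Metric.ball (0 : EuclideanSpace ℝ (Fin n)) (1 / 2))) :=
    ⟨by simp [measure_ball_lt_top]⟩
  have hfm := memLp_posPart_sub (hf.1.mono_measure (Measure.restrict_mono hhalf le_rfl)) (1 / 2)
  have hzero : eLpNorm (fun x => max (f x - 1 / 2) 0) 2
      (volume.restrict (Metric.ball 0 (1 / 2))) = 0 := by
    -- Every level `l k` is below `1/2` and every `s k` exceeds `1/4 = (1/2)²`, so each `P k`
    -- dominates the limiting energy.
    have hle : ∀ k, eLpNorm (fun x => max (f x - 1 / 2) 0) 2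
        (volume.restrict (Metric.ball 0 (1 / 2))) ^ 2 ≤ P k := by
      intro k
      refine pow_le_pow_left' ?_ 2
      have hsubk : Metric.ball (0 : EuclideanSpace ℝ (Fin n)) (1 / 2) ⊆ {x | ‖x‖ ^ 2 < s k} := by
        intro x hx
        rw [mem_ball_zero_iff] at hx
        have := hpos k
        have h0 := norm_nonneg x
        change ‖x‖ ^ 2 < 1 / 4 + 1 / 4 * (1 / 2) ^ k
        nlinarith
      refine (eLpNorm_mono_real fun x => ?_).trans
        (eLpNorm_mono_measure _ (Measure.restrict_mono hsubk le_rfl))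
      rw [Real.norm_of_nonneg (le_max_right _ _)]
      refine max_le_max ?_ le_rfl
      have := hpos k
      simp only [hl]
      linarith
    have := ge_of_tendsto' hlim hle
    exact pow_eq_zero_iff two_ne_zero |>.1 (le_antisymm this zero_le)
  rw [eLpNorm_eq_zero_iff hfm.1 (by norm_num)] at hzero
  rw [eLpNorm_exponent_top]
  refine eLpNormEssSup_le_of_ae_enorm_bound ?_
  filter_upwards [hzero] with x hx
  have hx' : max (f x - 1 / 2) 0 = 0 := hx
  have hx2 : f x - 1 / 2 ≤ 0 := max_eq_right_iff.1 hx'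
  rw [Real.enorm_eq_ofReal (le_max_right _ _)]
  exact ENNReal.ofReal_le_ofReal (max_le (by linarith) (by norm_num))

end DeGiorgi

theorem lemma2p3 (n : ℕ) (Λ : ℝ) (hΛ : 0 < Λ) :
    ∃ δ : ℝ, 0 < δ ∧
      ∀ (A : EuclideanSpace ℝ (Fin n) → Matrix (Fin n) (Fin n) ℝ)
        (f : EuclideanSpace ℝ (Fin n) → ℝ),
        DeGiorgi.IsUniformlyElliptic (Metric.ball 0 1) Λ A →
        DeGiorgi.MemH1 (Metric.ball 0 1) f →
        DeGiorgi.IsWeakSubsolution (Metric.ball 0 1) A f →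
        eLpNorm (fun x => max (f x) 0) 2 (volume.restrict (Metric.ball 0 1)) ≤
          ENNReal.ofReal δ →
        eLpNorm (fun x => max (f x) 0) ∞ (volume.restrict (Metric.ball 0 (1 / 2))) ≤
          ENNReal.ofReal (1 / 2) := by
  rcases eq_or_ne n 0 with rfl | hn
  · obtain ⟨δ, hδ, h⟩ := DeGiorgi.eLpNorm_top_le_of_dim_zero
    exact ⟨δ, hδ, fun _ _ _ _ _ hsmall => h _ hsmall⟩
  · exact DeGiorgi.exists_linfty_bound hn hΛ
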